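/- Let $n\ge 1$, let $K_w$ be a positive definite and $K_v$ a positive semidefinite real symmetric $n\times n$ matrix, and let $P\ge 0$. Consider the channel $Y_i=X_i+W_i$ with noisy feedback $Z_i=Y_i+V_i$, $i=1,\dots,n$, where $W^n\sim N(0,K_w)$ and $V^n\sim N(0,K_v)$. A coding scheme consists of a message $M$ (a random element of some measurable space) such that $M,W^n,V^n$ are independent, and measurable encoding functions giving the inputs $X_i=e_i(M,Z_1,\dots,Z_{i-1})$; it meets the power constraint if $\frac1n\sum_{i=1}^n \mathbb{E}X_i^2\le P$. Define $$\bar C_{fb,n}^{noise}=\sup \frac1n I(X^n\to Y^n|V^n),\qquad I(X^n\to Y^n|V^n)=\sum_{i=1}^n I(X^i;Y_i\,|\,Y^{i-1},V^n),$$ where the supremum is over all coding schemes that meet the power constraint, and information is measured in bits ($\log=\log_2$). Then $\bar C_{fb,n}^{noise}$ is finite, the supremum is attained, and it is also the supremum over those schemes whose message is an index uniformly distributed over a finite set $\{1,\dots,N\}$ ($N$ arbitrary). Moreover $\bar C_{fb,n}^{noise}$ equals the optimal value, which is attained, of the problem $$\text{maximize}\quad \frac{1}{2n}\log\frac{\det\big((I+B)K_w(I+B)^T+K_s\big)}{\det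 K_w}$$ over positive semidefinite matrices $K_s$ and strictly lower triangular real $n\times n$ matrices $B$ subject to $$\operatorname{tr}\big(K_s+B(K_v+K_w)B^T\big)\le nP .$$ Finally, for every feasible pair $(K_s,B)$ there is a coding scheme with message $S^n\sim N(0,K_s)$ and inputs $X^n=S^n+B(W^n+V^n)$ (Gaussian signalling with linear feedback, the Cover–Pombra scheme) that meets the power constraint and for which $\frac1n I(X^n\to Y^n|V^n)$ equals the objective at $(K_s,B)$; so such schemes attain $\bar C_{fb,n}^{noise}$. -/

import Mathlib

open MeasureTheory ProbabilityTheory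
open scoped ENNReal Matrix

noncomputable section

namespace NoisyFeedback

/-- Conditional mutual information `I(X; Y | Z)` in bits: the relative entropy of the joint law of
`(Z, X, Y)` with respect to the law under which `Z` has its own law and, given `Z`, the variables
`X` and `Y` are independent with their conditional laws. If densities exist, this is
`∫ f(x,y,z) log₂ (f(x,y|z) / (f(x|z) f(y|z)))`. -/
def condMutualInfo {Ω α β γ : Type} [MeasurableSpace Ω]
    [MeasurableSpace α] [StandardBorelSpace α] [Nonempty α]
    [MeasurableSpace β] [StandardBorelSpace β] [Nonempty β] [MeasurableSpace γ]
    (μ : Measure Ω) [IsFiniteMeasure μ] (X : Ω → α) (Y : Ω → β) (Z : Ω → γ) : ℝ≥0∞ :=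
  InformationTheory.klDiv (μ.map fun ω => (Z ω, X ω, Y ω))
      ((μ.map Z) ⊗ₘ (condDistrib X Z μ ×ₖ condDistrib Y Z μ))
    / ENNReal.ofReal (Real.log 2)

/-- The directed information `I(Xⁿ → Yⁿ | Vⁿ) = ∑ᵢ I(Xⁱ; Yᵢ | Yⁱ⁻¹, Vⁿ)`, in bits. -/
def directedInfo {Ω : Type} [MeasurableSpace Ω] (μ : Measure Ω) [IsFiniteMeasure μ] {n : ℕ}
    (X Y V : Ω → Fin n → ℝ) : ℝ≥0∞ :=
  ∑ i : Fin n, condMutualInfo μ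
    (fun ω (j : {j : Fin n // j ≤ i}) => X ω j)
    (fun ω => Y ω i)
    (fun ω => ((fun j : {j : Fin n // j < i} => Y ω j), V ω))

/-- A coding scheme over the block `1, …, n` with message space `𝓜`: the law of the message and
the encoding functions; the `i`-th one takes the message `M` and the feedback `Zⁱ⁻¹`. -/
structure FeedbackCode (n : ℕ) (𝓜 : Type) [MeasurableSpace 𝓜] where
  law : Measure 𝓜
  isProb : IsProbabilityMeasure law
  enc : (i : Fin n) → 𝓜 → ({j : Fin n // j < i} → ℝ) → ℝ
  measurable_enc : ∀ i, Measurable (Function.uncurry (enc i))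

attribute [instance] FeedbackCode.isProb

namespace FeedbackCode

variable {n : ℕ} {𝓜 : Type} [MeasurableSpace 𝓜]

/-- The channel inputs, determined recursively by the message `m` and the noises `w`, `v`:
`Xᵢ = eᵢ(m, Zⁱ⁻¹)`, where `Zⱼ = Yⱼ + vⱼ = Xⱼ + wⱼ + vⱼ`. -/
def input (c : FeedbackCode n 𝓜) (m : 𝓜) (w v : EuclideanSpace ℝ (Fin n)) (i : Fin n) : ℝ :=
  c.enc i m fun j => c.input m w v j.1 + w j.1 + v j.1
termination_by i
decreasing_by exact j.2

/-- The joint law of `(M, Wⁿ, Vⁿ)`: independent, with `Wⁿ ∼ N(0, Kw)` and `Vⁿ ∼ N(0, Kv)`. -/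
def jointLaw (c : FeedbackCode n 𝓜) (Kw Kv : Matrix (Fin n) (Fin n) ℝ) :
    Measure (𝓜 × EuclideanSpace ℝ (Fin n) × EuclideanSpace ℝ (Fin n)) :=
  c.law.prod ((multivariateGaussian 0 Kw).prod (multivariateGaussian 0 Kv))

instance (c : FeedbackCode n 𝓜) (Kw Kv : Matrix (Fin n) (Fin n) ℝ) :
    IsProbabilityMeasure (c.jointLaw Kw Kv) := by
  unfold jointLaw; infer_instance

/-- The power constraint `(1/n) ∑ᵢ E Xᵢ² ≤ P`. -/
def MeetsPower (c : FeedbackCode n 𝓜) (Kw Kv : Matrix (Fin n) (Fin n) ℝ) (P : ℝ) : Prop :=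
  (∑ i : Fin n, ∫⁻ p, ENNReal.ofReal (c.input p.1 p.2.1 p.2.2 i ^ 2) ∂(c.jointLaw Kw Kv)) / n
    ≤ ENNReal.ofReal P

/-- The rate `(1/n) I(Xⁿ → Yⁿ | Vⁿ)`, in bits, with `Yⁿ = Xⁿ + Wⁿ`. -/
def rate (c : FeedbackCode n 𝓜) (Kw Kv : Matrix (Fin n) (Fin n) ℝ) : ℝ≥0∞ :=
  directedInfo (c.jointLaw Kw Kv)
    (fun p i => c.input p.1 p.2.1 p.2.2 i)
    (fun p i => c.input p.1 p.2.1 p.2.2 i + p.2.1 i)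
    (fun p i => p.2.2 i) / n

end FeedbackCode

variable {n : ℕ}

/-- The rates of all coding schemes (with an arbitrary message) that meet the power constraint. -/
def rates (Kw Kv : Matrix (Fin n) (Fin n) ℝ) (P : ℝ) : Set ℝ≥0∞ :=
  {r | ∃ (𝓜 : Type) (_ : MeasurableSpace 𝓜) (c : FeedbackCode n 𝓜),
    c.MeetsPower Kw Kv P ∧ c.rate Kw Kv = r}

/-- The rates of the coding schemes that meet the power constraint and whose message is an index
uniformly distributed over a finite set. -/
def finiteMessageRates (Kw Kv : Matrix (Fin n) (Fin n) ℝ) (P : ℝ) : Set ℝ≥0∞ :=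
  {r | ∃ (N : ℕ) (c : FeedbackCode n (Fin N)),
    c.law = uniformOn Set.univ ∧ c.MeetsPower Kw Kv P ∧ c.rate Kw Kv = r}

/-- The upper bound on the `n`-block noisy feedback capacity: the optimal value of
`(1/n) I(Xⁿ → Yⁿ | Vⁿ)` over all coding schemes that meet the power constraint. -/
def upperBound (Kw Kv : Matrix (Fin n) (Fin n) ℝ) (P : ℝ) : ℝ≥0∞ :=
  sSup (rates Kw Kv P)

/-- The feasible pairs `(Ks, B)` of the matrix problem. -/
def Feasible (Kw Kv : Matrix (Fin n) (Fin n) ℝ) (P : ℝ) (Ks B : Matrix (Fin n) (Fin n) ℝ) : Prop :=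
  Ks.PosSemidef ∧ (∀ i j, i ≤ j → B i j = 0) ∧
    (Ks + B * (Kv + Kw) * Bᵀ).trace ≤ n * P

/-- The objective of the matrix problem. -/
def objective (Kw Ks B : Matrix (Fin n) (Fin n) ℝ) : ℝ :=
  1 / (2 * n) * Real.logb 2 (((1 + B) * Kw * (1 + B)ᵀ + Ks).det / Kw.det)

/-- The scheme with Gaussian signalling `Sⁿ ∼ N(0, Ks)` (the message) and linear feedback,
`Xⁿ = Sⁿ + B (Wⁿ + Vⁿ)`. -/
def IsCoverPombra (c : FeedbackCode n (EuclideanSpace ℝ (Fin n)))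
    (Ks B : Matrix (Fin n) (Fin n) ℝ) : Prop :=
  c.law = multivariateGaussian 0 Ks ∧
    ∀ (s w v : EuclideanSpace ℝ (Fin n)) (i : Fin n),
      c.input s w v i = s i + ∑ j, B i j * (w j + v j)

end NoisyFeedback

end

open NoisyFeedback

/-! Write `U = W + V` for the total noise, which is all that the encoder learns about the noises,
and compare the output law with a Gaussian reference. For any kernel `Q`, the golden formula says
that `I(X; Y | Z)` plus the divergence of `Y` given `Z` from `Q` equals the divergence of `Y` given
`(Z, X)` from `Q` (`klDiv_add_klDiv_eq`). At time `i` take `X = Xⁱ` and `Z = (Yⁱ⁻¹, Vⁿ)`. Given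
both, `Yᵢ` is Gaussian with the variance `sᵢ` of the `i`-th innovation of `Wⁿ`. If `Q` is also
Gaussian, with variance `dᵢ` and a mean linear in `Z`, the right side is explicit and depends only
on second moments (`FeedbackCode.stepInfo_add_klDiv`). All reference laws come from one unit
triangular factorization of a covariance `K` proposed for the corrected outputs `Y - BV`. When `K`
is their true second moment matrix, the right sides are `½ log (dᵢ / sᵢ)` and add up to half the log
of a ratio of determinants.

Converse: project the inputs linearly on `U`, so that `X = S + BU` with `S` orthogonal to `U`.
Causality makes `B` strictly lower triangular. Moreover `S` is orthogonal to `W` itself, because the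
error in estimating `W` from `U` is independent of `(M, U)`, of which `S` is a function. Hence `Y -
BV = S + (1 + B)W` has second moments `(1 + B) Kw (1 + B)ᵀ + Ks`, with `Ks` that of `S`, and the
power is the trace in the constraint. Dropping the nonnegative divergences bounds the rate by the
objective (`FeedbackCode.exists_feasible_of_meetsPower`, `FeedbackCode.rate_le_objective`).

Achievability: a scheme that sends `s(M) + BU` has corrected outputs `s(M) + (1 + B)W`, independent
of `V`. Each dropped divergence is at most that of their law from `N(0, K)` (`linearCode_klDiv_le`).
It vanishes for Gaussian `s(M)`, which gives equality (`exists_coverPombra`). The feasible set is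
compact, so an optimal pair exists and the supremum is attained.

Finite messages: realize the Gaussian signal as a function on the unit interval and replace it by
step functions on equal cells, close in `L²` and of no larger power. The channel noise smooths the
difference: by Cameron–Martin and data processing, the divergence of the corrected outputs is at
most a quadratic form in the `L²` error (`exists_klDiv_correctedLaw_le`), so the rates approach the
objective. -/

open InformationTheory
open scoped NNReal

namespace NoisyFeedback

/-! ### Divergence between conditionally Gaussian laws -/

section Divergence

variable {Ω α γ : Type*} [MeasurableSpace Ω] [MeasurableSpace α] [MeasurableSpace γ]

/-- The divergence of two laws with positive densities is the expected log-likelihood ratio. -/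
lemma klDiv_withDensity_eq_ofReal_integral_log {μ : Measure Ω} [IsProbabilityMeasure μ]
    {ρ : Measure α} {p q : α → ℝ} (hp : Measurable p) (hq : Measurable q)
    (hp0 : ∀ x, 0 < p x) (hq0 : ∀ x, 0 < q x) {T : Ω → α} (hT : Measurable T)
    (hμ : μ.map T = ρ.withDensity fun x => ENNReal.ofReal (p x))
    {ν : Measure α} [IsProbabilityMeasure ν]
    (hν : ν = ρ.withDensity fun x => ENNReal.ofReal (q x))
    (hint : Integrable (fun ω => Real.log (p (T ω) / q (T ω))) μ) :
    0 ≤ ∫ ω, Real.log (p (T ω) / q (T ω)) ∂μ ∧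
      klDiv (μ.map T) ν = ENNReal.ofReal (∫ ω, Real.log (p (T ω) / q (T ω)) ∂μ) := by
  have : IsProbabilityMeasure (μ.map T) := Measure.isProbabilityMeasure_map hT.aemeasurable
  have hw : μ.map T = ν.withDensity fun x => ENNReal.ofReal (p x / q x) := by
    rw [hμ, hν, ← withDensity_mul _ (by fun_prop) (by fun_prop)]
    congr 1
    funext x
    simp only [Pi.mul_apply]
    rw [← ENNReal.ofReal_mul (hq0 x).le, mul_div_cancel₀ _ (hq0 x).ne']
  have hac : μ.map T ≪ ν := hw ▸ withDensity_absolutelyContinuous _ _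
  have hllr : llr (μ.map T) ν =ᵐ[μ.map T] fun x => Real.log (p x / q x) := by
    refine hac.ae_le ?_
    have := Measure.rnDeriv_withDensity ν (f := fun x => ENNReal.ofReal (p x / q x)) (by fun_prop)
    rw [← hw] at this
    filter_upwards [this] with x hx
    rw [llr, hx, ENNReal.toReal_ofReal (div_pos (hp0 x) (hq0 x)).le]
  have hm : Measurable fun x => Real.log (p x / q x) := by fun_prop
  have hi : Integrable (llr (μ.map T) ν) (μ.map T) := by
    rw [integrable_congr hllr, integrable_map_measure hm.aestronglyMeasurable hT.aemeasurable]
    exact hint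
  have he : ∫ x, llr (μ.map T) ν x ∂(μ.map T) = ∫ ω, Real.log (p (T ω) / q (T ω)) ∂μ := by
    rw [integral_congr_ae hllr, integral_map hT.aemeasurable hm.aestronglyMeasurable]
  constructor
  · have := integral_llr_add_sub_measure_univ_nonneg hac hi
    simpa [he] using this
  · rw [klDiv_of_ac_of_integrable hac hi, he]
    simp

/-- The kernel `a ↦ N(f a, v)`. -/
noncomputable def gaussianKernel (f : α → ℝ) (hf : Measurable f) (v : ℝ≥0) : Kernel α ℝ where
  toFun a := gaussianReal (f a) v
  measurable' := measurable_gaussianReal.comp (hf.prodMk measurable_const)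

instance (f : α → ℝ) (hf : Measurable f) (v : ℝ≥0) : IsMarkovKernel (gaussianKernel f hf v) :=
  ⟨fun a => by change IsProbabilityMeasure (gaussianReal (f a) v); infer_instance⟩

lemma compProd_gaussianKernel (ρ : Measure α) [IsProbabilityMeasure ρ] {f : α → ℝ}
    (hf : Measurable f) {v : ℝ≥0} (hv : v ≠ 0) :
    ρ ⊗ₘ gaussianKernel f hf v =
      (ρ.prod volume).withDensity fun x => ENNReal.ofReal (gaussianPDFReal (f x.1) v x.2) := by
  have hm : Measurable fun x : α × ℝ => gaussianPDFReal (f x.1) v x.2 := by fun_prop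
  ext s hs
  rw [Measure.compProd_apply hs, withDensity_apply _ hs, ← lintegral_indicator hs,
    lintegral_prod _ (by
      apply AEMeasurable.indicator _ hs
      fun_prop)]
  refine lintegral_congr fun a => ?_
  change gaussianReal (f a) v _ = _
  rw [gaussianReal_apply _ hv, ← lintegral_indicator (measurable_prodMk_left hs)]
  rfl

/-- If `Y = f(A) + N` with `N ∼ N(0, v)` independent of `A`, the conditional law of `Y` given `A`
is `N(f(A), v)`. -/
lemma map_prodMk_eq_compProd_gaussianKernel {μ : Measure Ω} [IsProbabilityMeasure μ]
    {A : Ω → α} (hA : Measurable A) {N : Ω → ℝ} (hN : Measurable N) {f : α → ℝ}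
    (hf : Measurable f) {v : ℝ≥0} (hlaw : μ.map N = gaussianReal 0 v) (hind : IndepFun N A μ) :
    μ.map (fun ω => (A ω, f (A ω) + N ω)) = μ.map A ⊗ₘ gaussianKernel f hf v := by
  have : IsProbabilityMeasure (μ.map A) := Measure.isProbabilityMeasure_map hA.aemeasurable
  have h1 := (indepFun_iff_map_prod_eq_prod_map_map hA.aemeasurable hN.aemeasurable).1 hind.symm
  have h2 : (fun ω => (A ω, f (A ω) + N ω)) =
      (fun x : α × ℝ => (x.1, f x.1 + x.2)) ∘ fun ω => (A ω, N ω) := rfl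
  have hm : Measurable fun x : α × ℝ => (x.1, f x.1 + x.2) := by fun_prop
  rw [h2, ← Measure.map_map hm (by fun_prop), h1, hlaw]
  ext s hs
  rw [Measure.map_apply hm hs, Measure.prod_apply (hm hs), Measure.compProd_apply hs]
  refine lintegral_congr fun a => ?_
  change _ = gaussianReal (f a) v _
  have : gaussianReal (f a) v = (gaussianReal 0 v).map (fun y => f a + y) := by
    rw [gaussianReal_map_const_add]; simp
  rw [this, Measure.map_apply (by fun_prop) (measurable_prodMk_left hs)]
  rfl

lemma log_gaussianPDFReal_div {m m' : ℝ} {v v' : ℝ≥0} (hv : v ≠ 0) (hv' : v' ≠ 0) (y : ℝ) :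
    Real.log (gaussianPDFReal m v y / gaussianPDFReal m' v' y) =
      1 / 2 * Real.log (v' / v) + (y - m') ^ 2 / (2 * v') - (y - m) ^ 2 / (2 * v) := by
  have h0 : (0 : ℝ) < v := by positivity
  have h0' : (0 : ℝ) < v' := by positivity
  have hpi := Real.pi_pos
  rw [Real.log_div (gaussianPDFReal_pos _ _ _ hv).ne' (gaussianPDFReal_pos _ _ _ hv').ne',
    gaussianPDFReal_def, gaussianPDFReal_def]
  simp only
  rw [Real.log_mul (by positivity) (by positivity), Real.log_mul (by positivity) (by positivity),
    Real.log_exp, Real.log_exp, Real.log_inv, Real.log_inv, Real.log_sqrt (by positivity),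
    Real.log_sqrt (by positivity), Real.log_mul (by positivity) (by positivity),
    Real.log_mul (by positivity) h0'.ne', Real.log_div h0'.ne' h0.ne']
  ring

lemma integral_sq_of_map_eq_gaussianReal {μ : Measure Ω} [IsProbabilityMeasure μ] {N : Ω → ℝ}
    (hN : Measurable N) {v : ℝ≥0} (hlaw : μ.map N = gaussianReal 0 v) :
    MemLp N 2 μ ∧ ∫ ω, N ω ^ 2 ∂μ = v := by
  have h2 : MemLp id 2 (gaussianReal 0 v) := memLp_id_gaussianReal' 2 (by simp)
  constructor
  · rw [← hlaw] at h2
    simpa using (memLp_map_measure_iff (by fun_prop) hN.aemeasurable).1 h2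
  · have h3 : Var[id; gaussianReal 0 v] = v := variance_id_gaussianReal
    rw [variance_eq_integral (by fun_prop)] at h3
    simp only [id, integral_id_gaussianReal, sub_zero] at h3
    rw [← h3, ← hlaw, integral_map hN.aemeasurable (by fun_prop)]

/-- Divergence of the law of `(A, Y)`, where `Y = f(A) + N`, from the law under which `Y` is
`N(g(A), v')` given `A`. -/
lemma klDiv_compProd_gaussianKernel {μ : Measure Ω} [IsProbabilityMeasure μ]
    {A : Ω → α} (hA : Measurable A) {N : Ω → ℝ} (hN : Measurable N) {f g : α → ℝ}
    (hf : Measurable f) (hg : Measurable g) {v v' : ℝ≥0} (hv : v ≠ 0) (hv' : v' ≠ 0)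
    (hlaw : μ.map N = gaussianReal 0 v) (hind : IndepFun N A μ)
    (hL2 : MemLp (fun ω => f (A ω) + N ω - g (A ω)) 2 μ) :
    0 ≤ 1 / 2 * Real.log (v' / v) + (∫ ω, (f (A ω) + N ω - g (A ω)) ^ 2 ∂μ) / (2 * v') - 1 / 2 ∧
      klDiv (μ.map fun ω => (A ω, f (A ω) + N ω)) (μ.map A ⊗ₘ gaussianKernel g hg v') =
        ENNReal.ofReal (1 / 2 * Real.log (v' / v) +
          (∫ ω, (f (A ω) + N ω - g (A ω)) ^ 2 ∂μ) / (2 * v') - 1 / 2) := by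
  have : IsProbabilityMeasure (μ.map A) := Measure.isProbabilityMeasure_map hA.aemeasurable
  obtain ⟨hNL2, hN2⟩ := integral_sq_of_map_eq_gaussianReal hN hlaw
  have hlog : ∀ ω, Real.log (gaussianPDFReal (f (A ω)) v (f (A ω) + N ω) /
      gaussianPDFReal (g (A ω)) v' (f (A ω) + N ω)) = 1 / 2 * Real.log (v' / v) +
        (f (A ω) + N ω - g (A ω)) ^ 2 / (2 * v') - N ω ^ 2 / (2 * v) := by
    intro ω
    rw [log_gaussianPDFReal_div hv hv']
    ring
  have hi1 : Integrable (fun ω => (f (A ω) + N ω - g (A ω)) ^ 2 / (2 * (v' : ℝ))) μ :=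
    hL2.integrable_sq.div_const _
  have hi2 : Integrable (fun ω => N ω ^ 2 / (2 * (v : ℝ))) μ := hNL2.integrable_sq.div_const _
  have key := klDiv_withDensity_eq_ofReal_integral_log (μ := μ) (ρ := (μ.map A).prod volume)
    (p := fun x : α × ℝ => gaussianPDFReal (f x.1) v x.2)
    (q := fun x : α × ℝ => gaussianPDFReal (g x.1) v' x.2) (by fun_prop) (by fun_prop)
    (fun x => gaussianPDFReal_pos _ _ _ hv) (fun x => gaussianPDFReal_pos _ _ _ hv')
    (T := fun ω => (A ω, f (A ω) + N ω)) (by fun_prop)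
    (by rw [map_prodMk_eq_compProd_gaussianKernel hA hN hf hlaw hind,
          compProd_gaussianKernel _ hf hv])
    (compProd_gaussianKernel _ hg hv')
    (by
      simp only [hlog]
      exact ((integrable_const _).add hi1).sub hi2)
  -- The noise term contributes `E N² / (2v) = 1/2`.
  have hval : ∫ ω, Real.log (gaussianPDFReal (f (A ω)) v (f (A ω) + N ω) /
      gaussianPDFReal (g (A ω)) v' (f (A ω) + N ω)) ∂μ = 1 / 2 * Real.log (v' / v) +
          (∫ ω, (f (A ω) + N ω - g (A ω)) ^ 2 ∂μ) / (2 * v') - 1 / 2 := by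
    simp only [hlog]
    have hi3 : Integrable (fun ω => 1 / 2 * Real.log ((v' : ℝ) / v) +
        (f (A ω) + N ω - g (A ω)) ^ 2 / (2 * (v' : ℝ))) μ := (integrable_const _).add hi1
    rw [integral_sub hi3 hi2, integral_add (integrable_const _) hi1,
      integral_div, integral_div, hN2]
    have : (v : ℝ) ≠ 0 := by exact_mod_cast hv
    simp only [integral_const, probReal_univ, one_smul]
    field_simp
  simp only [hval] at key
  exact key

end Divergence

/-! ### The golden formula for conditional mutual information -/

lemma klDiv_map_measurableEquiv {α' β' : Type*} [MeasurableSpace α'] [MeasurableSpace β']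
    (μ ν : Measure α') [IsFiniteMeasure μ] [IsFiniteMeasure ν] (e : α' ≃ᵐ β') :
    klDiv (μ.map e) (ν.map e) = klDiv μ ν := by
  refine le_antisymm (klDiv_map_le _ _ e.measurable) ?_
  have h := klDiv_map_le (μ.map e) (ν.map e) e.symm.measurable
  rw [Measure.map_map e.symm.measurable e.measurable,
    Measure.map_map e.symm.measurable e.measurable] at h
  simpa using h

/-- Reordering of `(Z, Y, X)` into `(Z, X, Y)`. -/
def swapEquiv (γ β α : Type) [MeasurableSpace α] [MeasurableSpace β] [MeasurableSpace γ] :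
    (γ × β) × α ≃ᵐ γ × α × β :=
  MeasurableEquiv.prodAssoc.trans ((MeasurableEquiv.refl γ).prodCongr MeasurableEquiv.prodComm)

/-- Given `Z`, independent variables may be drawn in either order. Drawing `Y` before `X` prepares
the chain rule for divergence, which splits off the pair `(Z, Y)`. -/
lemma map_swapEquiv_compProd {α β γ : Type} [MeasurableSpace α] [MeasurableSpace β]
    [MeasurableSpace γ] (ρ : Measure γ) [IsProbabilityMeasure ρ] (κ : Kernel γ α)
    [IsMarkovKernel κ] (η : Kernel γ β) [IsMarkovKernel η] :
    ((ρ ⊗ₘ η) ⊗ₘ (κ.prodMkRight β)).map (swapEquiv γ β α) = ρ ⊗ₘ (κ ×ₖ η) := by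
  ext s hs
  rw [Measure.map_apply (MeasurableEquiv.measurable _) hs,
    Measure.compProd_apply (MeasurableEquiv.measurable _ hs),
    Measure.lintegral_compProd
      (Kernel.measurable_kernel_prodMk_left (MeasurableEquiv.measurable _ hs)),
    Measure.compProd_apply hs]
  refine lintegral_congr fun z => ?_
  rw [Kernel.prod_apply, Measure.prod_apply_symm (measurable_prodMk_left hs)]
  rfl

section Golden

variable {Ω α β γ : Type} [MeasurableSpace Ω]
    [MeasurableSpace α] [StandardBorelSpace α] [Nonempty α]
    [MeasurableSpace β] [StandardBorelSpace β] [Nonempty β] [MeasurableSpace γ]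

/-- The golden formula: for every reference kernel `Q`, the conditional mutual information (in
nats) plus the divergence of the law of `Y` given `Z` from `Q` is the divergence of the law of `Y`
given `(Z, X)` from `Q`. -/
lemma klDiv_add_klDiv_eq (μ : Measure Ω) [IsProbabilityMeasure μ] {X : Ω → α} {Y : Ω → β}
    {Z : Ω → γ} (hX : Measurable X) (hY : Measurable Y) (hZ : Measurable Z)
    (Q : Kernel γ β) [IsMarkovKernel Q] :
    klDiv (μ.map fun ω => (Z ω, X ω, Y ω))
        ((μ.map Z) ⊗ₘ (condDistrib X Z μ ×ₖ condDistrib Y Z μ)) +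
      klDiv (μ.map fun ω => (Z ω, Y ω)) (μ.map Z ⊗ₘ Q) =
    klDiv (μ.map fun ω => ((Z ω, X ω), Y ω))
      (μ.map (fun ω => (Z ω, X ω)) ⊗ₘ Q.prodMkRight α) := by
  have : IsProbabilityMeasure (μ.map Z) := Measure.isProbabilityMeasure_map hZ.aemeasurable
  have : IsProbabilityMeasure (μ.map fun ω => (Z ω, Y ω)) :=
    Measure.isProbabilityMeasure_map (by fun_prop)
  have : IsProbabilityMeasure (μ.map fun ω => (Z ω, X ω)) :=
    Measure.isProbabilityMeasure_map (by fun_prop)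
  have hP : μ.map (fun ω => (Z ω, X ω, Y ω)) =
      ((μ.map fun ω => (Z ω, Y ω)) ⊗ₘ condDistrib X (fun ω => (Z ω, Y ω)) μ).map
        (swapEquiv γ β α) := by
    rw [compProd_map_condDistrib hX.aemeasurable,
      Measure.map_map (MeasurableEquiv.measurable _) (by fun_prop)]
    rfl
  have hYZ : μ.map Z ⊗ₘ condDistrib Y Z μ = μ.map fun ω => (Z ω, Y ω) :=
    compProd_map_condDistrib hY.aemeasurable
  -- Both laws have the same `(Z, Y)` marginal, so the information only compares the laws of `X`
  -- given `(Z, Y)` and given `Z`.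
  have h1 : klDiv (μ.map fun ω => (Z ω, X ω, Y ω))
      ((μ.map Z) ⊗ₘ (condDistrib X Z μ ×ₖ condDistrib Y Z μ)) =
      klDiv ((μ.map fun ω => (Z ω, Y ω)) ⊗ₘ condDistrib X (fun ω => (Z ω, Y ω)) μ)
        ((μ.map fun ω => (Z ω, Y ω)) ⊗ₘ (condDistrib X Z μ).prodMkRight β) := by
    rw [hP, ← map_swapEquiv_compProd, klDiv_map_measurableEquiv, hYZ]
  have h2 : klDiv (μ.map fun ω => (Z ω, X ω, Y ω))
      ((μ.map Z) ⊗ₘ (condDistrib X Z μ ×ₖ Q)) =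
      klDiv (μ.map fun ω => (Z ω, Y ω)) (μ.map Z ⊗ₘ Q) +
      klDiv ((μ.map fun ω => (Z ω, Y ω)) ⊗ₘ condDistrib X (fun ω => (Z ω, Y ω)) μ)
        ((μ.map fun ω => (Z ω, Y ω)) ⊗ₘ (condDistrib X Z μ).prodMkRight β) := by
    rw [hP, ← map_swapEquiv_compProd, klDiv_map_measurableEquiv, klDiv_compProd_eq_add]
  rw [h1, add_comm, ← h2]
  -- As `Q` ignores `X`, drawing `X` and `Y` independently given `Z` is the same as drawing `(Z, X)`
  -- and then `Y` from `Q`.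
  have h3 : (μ.map Z) ⊗ₘ (condDistrib X Z μ ×ₖ Q) =
      (μ.map (fun ω => (Z ω, X ω)) ⊗ₘ Q.prodMkRight α).map MeasurableEquiv.prodAssoc := by
    rw [← compProd_map_condDistrib hX.aemeasurable]
    ext s hs
    rw [Measure.map_apply (MeasurableEquiv.measurable _) hs,
      Measure.compProd_apply (MeasurableEquiv.measurable _ hs),
      Measure.lintegral_compProd
        (Kernel.measurable_kernel_prodMk_left (MeasurableEquiv.measurable _ hs)),
      Measure.compProd_apply hs]
    refine lintegral_congr fun z => ?_
    rw [Kernel.prod_apply, Measure.prod_apply (measurable_prodMk_left hs)]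
    rfl
  have h4 : (μ.map fun ω => (Z ω, X ω, Y ω)) =
      (μ.map fun ω => ((Z ω, X ω), Y ω)).map MeasurableEquiv.prodAssoc := by
    rw [Measure.map_map (MeasurableEquiv.measurable _) (by fun_prop)]
    rfl
  have : IsProbabilityMeasure (μ.map fun ω => ((Z ω, X ω), Y ω)) :=
    Measure.isProbabilityMeasure_map (by fun_prop)
  rw [h3, h4, klDiv_map_measurableEquiv]

/-- Conditional mutual information (in nats) across an additive Gaussian channel with side
information, relative to the reference law `N(g(Z), v')` of the output given `Z`. -/
lemma klDiv_add_klDiv_gaussian {μ : Measure Ω} [IsProbabilityMeasure μ] {X : Ω → α} {Y : Ω → ℝ}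
    {Z : Ω → γ} {N : Ω → ℝ} (hX : Measurable X) (hY : Measurable Y) (hZ : Measurable Z)
    (hN : Measurable N) {f : γ × α → ℝ} (hf : Measurable f) (hYN : ∀ ω, Y ω = f (Z ω, X ω) + N ω)
    {g : γ → ℝ} (hg : Measurable g) {v v' : ℝ≥0} (hv : v ≠ 0) (hv' : v' ≠ 0)
    (hlaw : μ.map N = gaussianReal 0 v) (hind : IndepFun N (fun ω => (Z ω, X ω)) μ)
    (hL2 : MemLp (fun ω => Y ω - g (Z ω)) 2 μ) :
    0 ≤ 1 / 2 * Real.log (v' / v) + (∫ ω, (Y ω - g (Z ω)) ^ 2 ∂μ) / (2 * v') - 1 / 2 ∧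
    klDiv (μ.map fun ω => (Z ω, X ω, Y ω))
        ((μ.map Z) ⊗ₘ (condDistrib X Z μ ×ₖ condDistrib Y Z μ)) +
      klDiv (μ.map fun ω => (Z ω, Y ω)) (μ.map Z ⊗ₘ gaussianKernel g hg v') =
    ENNReal.ofReal (1 / 2 * Real.log (v' / v) +
      (∫ ω, (Y ω - g (Z ω)) ^ 2 ∂μ) / (2 * v') - 1 / 2) := by
  rw [klDiv_add_klDiv_eq μ hX hY hZ]
  have hY' : Y = fun ω => f (Z ω, X ω) + N ω := funext hYN
  subst hY'
  exact klDiv_compProd_gaussianKernel (A := fun ω => (Z ω, X ω)) (by fun_prop) hN hf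
    (g := fun a => g a.1) (by fun_prop) hv hv' hlaw hind hL2

end Golden

end NoisyFeedback

namespace NoisyFeedback

/-! ### Triangular factorization and compactness of the matrix problem -/

section Matrices

variable {n : ℕ}

/-- `L` is unit lower triangular and diagonalizes `K` by congruence, with positive diagonal `d`. -/
structure IsUnitLDL (K L : Matrix (Fin n) (Fin n) ℝ) (d : Fin n → ℝ≥0) : Prop where
  diag_eq_one : ∀ i, L i i = 1
  lower : ∀ i j, i < j → L i j = 0
  conj : L * K * Lᵀ = Matrix.diagonal fun i => (d i : ℝ)
  ne_zero : ∀ i, d i ≠ 0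

namespace IsUnitLDL

variable {K L : Matrix (Fin n) (Fin n) ℝ} {d : Fin n → ℝ≥0}

lemma det_eq_one (h : IsUnitLDL K L d) : L.det = 1 := by
  rw [Matrix.det_of_isLowerTriangular L (fun i j hij => h.lower i j hij)]
  simp [h.diag_eq_one]

lemma isUnit_det (h : IsUnitLDL K L d) : IsUnit L.det := by simp [h.det_eq_one]

lemma det_eq (h : IsUnitLDL K L d) : K.det = ∏ i, (d i : ℝ) := by
  have := congrArg Matrix.det h.conj
  simpa [h.det_eq_one] using this

/-- `L K = D (Lᵀ)⁻¹` is upper triangular. For a vector `x` of covariance `K`, this says that the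
innovation `(L x)ᵢ` is uncorrelated with the entries of `x` before `i`. -/
lemma mul_apply_eq_zero (h : IsUnitLDL K L d) {i j : Fin n} (hij : j < i) : (L * K) i j = 0 := by
  have hT : IsUnit (Lᵀ).det := by simp [h.det_eq_one]
  have h1 : L * K = Matrix.diagonal (fun i => (d i : ℝ)) * (Lᵀ)⁻¹ := by
    rw [← h.conj, Matrix.mul_nonsing_inv_cancel_right _ _ hT]
  have : Invertible Lᵀ := Matrix.invertibleOfIsUnitDet _ hT
  have hU : Matrix.BlockTriangular Lᵀ (id : Fin n → Fin n) :=
    fun i j hij => h.lower j i hij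
  rw [h1, Matrix.diagonal_mul, Matrix.blockTriangular_inv_of_blockTriangular hU hij, mul_zero]

end IsUnitLDL

/-- Rescaling the rows of a lower triangular diagonalizing matrix makes its diagonal one. The new
diagonal entries stay positive because congruence by an invertible matrix preserves definiteness. -/
lemma exists_isUnitLDL {K : Matrix (Fin n) (Fin n) ℝ} (hK : K.PosDef) :
    ∃ L d, IsUnitLDL K L d := by
  set L₀ : Matrix (Fin n) (Fin n) ℝ := LDL.lowerInv hK with hL₀
  have hlow : ∀ i j, i < j → L₀ i j = 0 := fun i j hij => LDL.lowerInv_triangular hK hij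
  have hdet : L₀.det ≠ 0 := (Matrix.isUnit_det_of_invertible L₀).ne_zero
  have hdiag : ∀ i, L₀ i i ≠ 0 := by
    rw [Matrix.det_of_isLowerTriangular L₀ (fun i j hij => hlow i j hij)] at hdet
    exact fun i => Finset.prod_ne_zero_iff.1 hdet i (Finset.mem_univ i)
  set a : Fin n → ℝ := fun i => (L₀ i i)⁻¹
  set L := Matrix.diagonal a * L₀
  have hconj : L * K * Lᵀ = Matrix.diagonal fun i => a i * LDL.diagEntries hK i * a i := by
    have h0 : L₀ * K * L₀ᵀ = Matrix.diagonal (LDL.diagEntries hK) := by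
      have := LDL.diag_eq_lowerInv_conj hK
      rw [Matrix.conjTranspose_eq_transpose_of_trivial] at this
      exact this.symm
    calc L * K * Lᵀ = Matrix.diagonal a * (L₀ * K * L₀ᵀ) * Matrix.diagonal a := by
          simp only [L, Matrix.transpose_mul, Matrix.diagonal_transpose, Matrix.mul_assoc]
      _ = _ := by rw [h0, Matrix.diagonal_mul_diagonal, Matrix.diagonal_mul_diagonal]
  have hinj : Function.Injective L.vecMul := by
    refine Matrix.vecMul_injective_of_isUnit ?_
    rw [Matrix.isUnit_iff_isUnit_det, Matrix.det_mul, Matrix.det_diagonal]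
    refine IsUnit.mk0 _ (mul_ne_zero (Finset.prod_ne_zero_iff.2 fun i _ => inv_ne_zero (hdiag i))
      hdet)
  have hpos : (L * K * Lᵀ).PosDef := by
    have := hK.mul_mul_conjTranspose_same hinj
    rwa [Matrix.conjTranspose_eq_transpose_of_trivial] at this
  have hd : ∀ i, 0 < a i * LDL.diagEntries hK i * a i := fun i => by
    have := hpos.diag_pos (i := i)
    rwa [hconj, Matrix.diagonal_apply_eq] at this
  refine ⟨L, fun i => ⟨_, (hd i).le⟩, ?_, ?_, ?_, ?_⟩
  · intro i
    simp [L, Matrix.diagonal_mul, a, hdiag i]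
  · intro i j hij
    simp [L, Matrix.diagonal_mul, hlow i j hij]
  · rw [hconj]; rfl
  · intro i h
    exact (hd i).ne' (congrArg NNReal.toReal h)

lemma det_one_add_of_strictLower {B : Matrix (Fin n) (Fin n) ℝ} (hB : ∀ i j, i ≤ j → B i j = 0) :
    (1 + B).det = 1 := by
  rw [Matrix.det_of_isLowerTriangular (1 + B) fun i j hij => by
    have hij : i < j := hij
    simp [Matrix.one_apply_ne hij.ne, hB i j hij.le]]
  simp [hB]

lemma posDef_outputCov {Kw Ks B : Matrix (Fin n) (Fin n) ℝ} (hKw : Kw.PosDef)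
    (hKs : Ks.PosSemidef) (hB : ∀ i j, i ≤ j → B i j = 0) :
    ((1 + B) * Kw * (1 + B)ᵀ + Ks).PosDef := by
  refine Matrix.PosDef.add_posSemidef ?_ hKs
  have hinj : Function.Injective (1 + B).vecMul := by
    refine Matrix.vecMul_injective_of_isUnit ?_
    rw [Matrix.isUnit_iff_isUnit_det, det_one_add_of_strictLower hB]
    exact isUnit_one
  have := hKw.mul_mul_conjTranspose_same hinj
  rwa [Matrix.conjTranspose_eq_transpose_of_trivial] at this

lemma posSemidef_mul_mul_transpose {K : Matrix (Fin n) (Fin n) ℝ} (hK : K.PosSemidef)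
    (B : Matrix (Fin n) (Fin n) ℝ) : (B * K * Bᵀ).PosSemidef := by
  have := hK.mul_mul_conjTranspose_same B
  rwa [Matrix.conjTranspose_eq_transpose_of_trivial] at this

/-- Test the quadratic form on `eᵢ ± eⱼ` and use that each diagonal entry is at most the trace. -/
lemma abs_apply_le_trace {K : Matrix (Fin n) (Fin n) ℝ} (hK : K.PosSemidef) (i j : Fin n) :
    |K i j| ≤ K.trace := by
  have hsym : K j i = K i j := by simpa using hK.isHermitian.apply i j
  have hle : ∀ k, K k k ≤ K.trace := fun k =>
    Finset.single_le_sum (f := fun k => K k k) (fun l _ => hK.diag_nonneg) (Finset.mem_univ k)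
  have key : ∀ c : ℝ, 0 ≤ K i i + c * K i j + (c * K i j + c * c * K j j) := fun c => by
    have := hK.dotProduct_mulVec_nonneg (Pi.single i 1 + Pi.single j c)
    simp only [star_trivial, Matrix.mulVec_add, dotProduct_add, add_dotProduct,
      Matrix.mulVec_single, single_dotProduct, Pi.smul_apply, Matrix.col_apply] at this
    simp only [op_smul_eq_mul, one_mul, mul_one, hsym] at this
    linarith
  have h1 := key 1
  have h2 := key (-1)
  have := hle i
  have := hle j
  rw [abs_le]
  constructor <;> linarith

/-- In the coordinates `B = C L` the trace becomes the weighted sum of squares `∑ Cᵢₖ² dₖ`, which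
bounds each entry of `C` and hence of `B`. -/
lemma exists_abs_le_of_trace_le {K : Matrix (Fin n) (Fin n) ℝ} (hK : K.PosDef) (t : ℝ) :
    ∃ C, ∀ B : Matrix (Fin n) (Fin n) ℝ, (B * K * Bᵀ).trace ≤ t → ∀ i j, |B i j| ≤ C := by
  obtain ⟨L, d, hL⟩ := exists_isUnitLDL hK
  refine ⟨∑ j, ∑ k, √(t / d k) * |L k j|, fun B hB i j => ?_⟩
  set C := B * L⁻¹
  have hBC : B = C * L := by simp [C, Matrix.nonsing_inv_mul_cancel_right _ _ hL.isUnit_det]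
  have htr : (B * K * Bᵀ).trace = ∑ i, ∑ k, C i k ^ 2 * d k := by
    have : B * K * Bᵀ = C * (L * K * Lᵀ) * Cᵀ := by
      rw [hBC]; simp only [Matrix.transpose_mul, Matrix.mul_assoc]
    rw [this, hL.conj, Matrix.trace]
    refine Finset.sum_congr rfl fun i _ => ?_
    rw [Matrix.diag_apply, Matrix.mul_apply]
    refine Finset.sum_congr rfl fun k _ => ?_
    rw [Matrix.mul_diagonal, Matrix.transpose_apply]
    ring
  have hC : ∀ k, |C i k| ≤ √(t / d k) := fun k => by
    have hdk : (0 : ℝ) < d k := by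
      have := hL.ne_zero k
      positivity
    refine Real.abs_le_sqrt ?_
    rw [le_div_iff₀ hdk]
    refine le_trans ?_ (htr ▸ hB)
    refine le_trans ?_ (Finset.single_le_sum (f := fun i => ∑ k, C i k ^ 2 * (d k : ℝ))
      (fun i _ => Finset.sum_nonneg fun k _ => by positivity) (Finset.mem_univ i))
    exact Finset.single_le_sum (f := fun k => C i k ^ 2 * (d k : ℝ))
      (fun k _ => by positivity) (Finset.mem_univ k)
  calc |B i j| = |∑ k, C i k * L k j| := by rw [hBC, Matrix.mul_apply]
    _ ≤ ∑ k, |C i k * L k j| := Finset.abs_sum_le_sum_abs _ _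
    _ ≤ ∑ k, √(t / d k) * |L k j| := by
        refine Finset.sum_le_sum fun k _ => ?_
        rw [abs_mul]
        exact mul_le_mul_of_nonneg_right (hC k) (abs_nonneg _)
    _ ≤ _ := Finset.single_le_sum (f := fun j => ∑ k, √(t / d k) * |L k j|)
        (fun j _ => Finset.sum_nonneg fun k _ => by positivity) (Finset.mem_univ j)

lemma isClosed_posSemidef : IsClosed {K : Matrix (Fin n) (Fin n) ℝ | K.PosSemidef} := by
  simp only [Matrix.posSemidef_iff_dotProduct_mulVec, Matrix.IsHermitian, Set.ofPred_and,
    Set.ofPred_forall]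
  refine IsClosed.inter (isClosed_eq (by fun_prop) continuous_id) (isClosed_iInter fun x => ?_)
  exact isClosed_le continuous_const (by fun_prop)

lemma isCompact_setOf_abs_le (C : ℝ) :
    IsCompact {K : Matrix (Fin n) (Fin n) ℝ | ∀ i j, |K i j| ≤ C} := by
  have h : IsCompact (Set.univ.pi fun _ : Fin n => Set.univ.pi fun _ : Fin n => Set.Icc (-C) C) :=
    isCompact_univ_pi fun _ => isCompact_univ_pi fun _ => isCompact_Icc
  refine IsCompact.of_isClosed_subset h ?_ fun K hK => ?_
  · simp only [Set.ofPred_forall]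
    exact isClosed_iInter fun i => isClosed_iInter fun j =>
      isClosed_le (by fun_prop) continuous_const
  · exact fun i _ j _ => abs_le.1 (hK i j)

/-- Both parts of the constrained trace are nonnegative, so each is at most `nP`. The first bounds
`Ks`; the second bounds `B` because `Kv + Kw` is definite even when `Kv` is singular. -/
lemma isCompact_feasible {Kw Kv : Matrix (Fin n) (Fin n) ℝ} (hKw : Kw.PosDef)
    (hKv : Kv.PosSemidef) (P : ℝ) :
    IsCompact {p : Matrix (Fin n) (Fin n) ℝ × Matrix (Fin n) (Fin n) ℝ |
      Feasible Kw Kv P p.1 p.2} := by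
  have hKu : (Kv + Kw).PosDef := Matrix.PosDef.posSemidef_add hKv hKw
  obtain ⟨C, hC⟩ := exists_abs_le_of_trace_le hKu (n * P)
  refine ((isCompact_setOf_abs_le (n * P)).prod (isCompact_setOf_abs_le C)).of_isClosed_subset
    ?_ ?_
  · simp only [Feasible, Set.ofPred_and, Set.ofPred_forall]
    refine IsClosed.inter (isClosed_posSemidef.preimage continuous_fst) (IsClosed.inter ?_ ?_)
    · refine isClosed_iInter fun i => isClosed_iInter fun j => isClosed_iInter fun _ => ?_
      exact isClosed_eq (by fun_prop) continuous_const
    · exact isClosed_le (by fun_prop) continuous_const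
  · rintro ⟨Ks, B⟩ ⟨h1, -, h3⟩
    rw [Matrix.trace_add] at h3
    have h4 := (posSemidef_mul_mul_transpose hKu.posSemidef B).trace_nonneg
    have h5 := h1.trace_nonneg
    exact ⟨fun i j => (abs_apply_le_trace h1 i j).trans (by linarith), hC B (by linarith)⟩

/-- The matrix problem has an optimal solution. -/
lemma exists_optimal_feasible {Kw Kv : Matrix (Fin n) (Fin n) ℝ} (hKw : Kw.PosDef)
    (hKv : Kv.PosSemidef) {P : ℝ} (hP : 0 ≤ P) :
    ∃ Ks B, Feasible Kw Kv P Ks B ∧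
      ∀ Ks' B', Feasible Kw Kv P Ks' B' → objective Kw Ks' B' ≤ objective Kw Ks B := by
  have hcont : ContinuousOn (fun p : Matrix (Fin n) (Fin n) ℝ × Matrix (Fin n) (Fin n) ℝ =>
      objective Kw p.1 p.2) {p | Feasible Kw Kv P p.1 p.2} := by
    unfold objective
    refine ContinuousOn.mul continuousOn_const (ContinuousOn.div_const
      (ContinuousOn.log (Continuous.continuousOn (by fun_prop)) ?_) _)
    rintro ⟨Ks, B⟩ ⟨h1, h2, -⟩
    exact (div_pos (posDef_outputCov hKw h1 h2).det_pos hKw.det_pos).ne'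
  obtain ⟨⟨Ks, B⟩, hf, hmax⟩ := (isCompact_feasible hKw hKv P).exists_isMaxOn
    ⟨(0, 0), Matrix.PosSemidef.zero, by simp, by simp; positivity⟩ hcont
  exact ⟨Ks, B, hf, fun Ks' B' h => hmax (a := (Ks', B')) h⟩

/-- Unit triangular matrices have determinant one, so both determinants are products of innovation
variances and the objective splits over time. -/
lemma objective_eq_sum {Kw Ks B Lw L : Matrix (Fin n) (Fin n) ℝ} {s d : Fin n → ℝ≥0}
    (hw : IsUnitLDL Kw Lw s) (h : IsUnitLDL ((1 + B) * Kw * (1 + B)ᵀ + Ks) L d) :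
    objective Kw Ks B = (∑ i, 1 / 2 * Real.log (d i / s i)) / Real.log 2 / n := by
  unfold objective
  have hd : ∀ i, (d i : ℝ) / s i ≠ 0 := fun i => by
    have := h.ne_zero i
    have := hw.ne_zero i
    positivity
  rw [hw.det_eq, h.det_eq, ← Finset.prod_div_distrib, Real.logb,
    Real.log_prod (fun i _ => hd i), ← Finset.mul_sum]
  field_simp

end Matrices

end NoisyFeedback

namespace NoisyFeedback

/-! ### Calculus of second cross moments -/

section CrossMoment

variable {Ω ι κ : Type*} [MeasurableSpace Ω]

/-- The matrix `E[F Gᵀ]` of second cross moments of two random vectors. -/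
noncomputable def crossMoment (μ : Measure Ω) (F : Ω → ι → ℝ) (G : Ω → κ → ℝ) : Matrix ι κ ℝ :=
  Matrix.of fun i j => ∫ ω, F ω i * G ω j ∂μ

/-- All coordinates of the random vector `F` are square integrable. -/
def CoordL2 (μ : Measure Ω) (F : Ω → ι → ℝ) : Prop := ∀ i, MemLp (fun ω => F ω i) 2 μ

variable {μ : Measure Ω} {F F' : Ω → ι → ℝ} {G G' : Ω → κ → ℝ}

lemma CoordL2.add (h : CoordL2 μ F) (h' : CoordL2 μ F') : CoordL2 μ fun ω => F ω + F' ω :=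
  fun i => (h i).add (h' i)

lemma CoordL2.sub (h : CoordL2 μ F) (h' : CoordL2 μ F') : CoordL2 μ fun ω => F ω - F' ω :=
  fun i => (h i).sub (h' i)

lemma CoordL2.mulVec [Fintype κ] (h : CoordL2 μ G) (A : Matrix ι κ ℝ) :
    CoordL2 μ fun ω => A *ᵥ G ω := fun i => by
  simp only [Matrix.mulVec, dotProduct]
  exact memLp_finsetSum _ fun j _ => (h j).const_mul _

lemma CoordL2.integrable_mul (h : CoordL2 μ F) (h' : CoordL2 μ G) (i : ι) (j : κ) :
    Integrable (fun ω => F ω i * G ω j) μ := MemLp.integrable_mul (h i) (h' j)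

lemma crossMoment_transpose : (crossMoment μ F G)ᵀ = crossMoment μ G F := by
  ext i j
  simp [crossMoment, mul_comm]

lemma crossMoment_add_left (h : CoordL2 μ F) (h' : CoordL2 μ F') (hG : CoordL2 μ G) :
    crossMoment μ (fun ω => F ω + F' ω) G = crossMoment μ F G + crossMoment μ F' G := by
  ext i j
  simp only [crossMoment, Matrix.of_apply, Matrix.add_apply, Pi.add_apply, add_mul]
  exact integral_add (h.integrable_mul hG i j) (h'.integrable_mul hG i j)

lemma crossMoment_sub_left (h : CoordL2 μ F) (h' : CoordL2 μ F') (hG : CoordL2 μ G) :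
    crossMoment μ (fun ω => F ω - F' ω) G = crossMoment μ F G - crossMoment μ F' G := by
  ext i j
  simp only [crossMoment, Matrix.of_apply, Matrix.sub_apply, Pi.sub_apply, sub_mul]
  exact integral_sub (h.integrable_mul hG i j) (h'.integrable_mul hG i j)

lemma crossMoment_add_right (hF : CoordL2 μ F) (h : CoordL2 μ G) (h' : CoordL2 μ G') :
    crossMoment μ F (fun ω => G ω + G' ω) = crossMoment μ F G + crossMoment μ F G' := by
  rw [← crossMoment_transpose, crossMoment_add_left h h' hF, Matrix.transpose_add,
    crossMoment_transpose, crossMoment_transpose]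

lemma crossMoment_mulVec_left [Fintype ι] {τ : Type*} (h : CoordL2 μ F) (hG : CoordL2 μ G)
    (A : Matrix τ ι ℝ) :
    crossMoment μ (fun ω => A *ᵥ F ω) G = A * crossMoment μ F G := by
  ext i j
  simp only [crossMoment, Matrix.of_apply, Matrix.mul_apply, Matrix.mulVec, dotProduct,
    Finset.sum_mul, mul_assoc]
  rw [integral_finsetSum _ fun k _ => (h.integrable_mul hG k j).const_mul _]
  simp only [integral_const_mul]

lemma crossMoment_mulVec_right [Fintype κ] {τ : Type*} (hF : CoordL2 μ F) (h : CoordL2 μ G)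
    (A : Matrix τ κ ℝ) :
    crossMoment μ F (fun ω => A *ᵥ G ω) = crossMoment μ F G * Aᵀ := by
  rw [← crossMoment_transpose, crossMoment_mulVec_left h hF, Matrix.transpose_mul,
    crossMoment_transpose]

lemma posSemidef_crossMoment_self [Fintype ι] (h : CoordL2 μ F) :
    (crossMoment μ F F).PosSemidef := by
  rw [Matrix.posSemidef_iff_dotProduct_mulVec]
  constructor
  · rw [Matrix.IsHermitian, Matrix.conjTranspose_eq_transpose_of_trivial, crossMoment_transpose]
  · intro x
    have h1 := congrFun (congrFun (crossMoment_mulVec_right (τ := Unit)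
      (h.mulVec (Matrix.of fun _ : Unit => x)) h (Matrix.of fun _ : Unit => x)) ()) ()
    rw [crossMoment_mulVec_left h h] at h1
    have h2 : star x ⬝ᵥ crossMoment μ F F *ᵥ x = ((Matrix.of fun _ : Unit => x) *
        crossMoment μ F F * (Matrix.of fun _ : Unit => x)ᵀ) () () := by
      rw [star_trivial, Matrix.mul_assoc, Matrix.mul_apply]
      simp only [Matrix.mul_apply, dotProduct, Matrix.mulVec, Matrix.of_apply,
        Matrix.transpose_apply]
    rw [h2, ← h1]
    exact integral_nonneg fun ω => mul_self_nonneg _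

lemma crossMoment_map {Ω' : Type*} [MeasurableSpace Ω'] {T : Ω' → Ω} {ν : Measure Ω'}
    (hT : Measurable T) (hν : ν.map T = μ) (hF : ∀ i, Measurable fun ω => F ω i)
    (hG : ∀ j, Measurable fun ω => G ω j) :
    crossMoment ν (fun ω => F (T ω)) (fun ω => G (T ω)) = crossMoment μ F G := by
  ext i j
  simp only [crossMoment, Matrix.of_apply, ← hν]
  rw [integral_map hT.aemeasurable]
  exact ((hF i).mul (hG j)).aestronglyMeasurable

end CrossMoment

/-! ### Linear images of two independent Gaussian vectors -/

section Gaussian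

variable {n : ℕ} {ι κ : Type*}

lemma coordL2_multivariateGaussian (K : Matrix (Fin n) (Fin n) ℝ) :
    CoordL2 (multivariateGaussian 0 K) WithLp.ofLp := fun i => by
  exact IsGaussian.memLp_dual (multivariateGaussian 0 K) (EuclideanSpace.proj i) 2 (by simp)

lemma integral_apply_multivariateGaussian (K : Matrix (Fin n) (Fin n) ℝ) (i : Fin n) :
    ∫ x, WithLp.ofLp x i ∂(multivariateGaussian 0 K) = 0 := by
  have := (EuclideanSpace.proj i : EuclideanSpace ℝ (Fin n) →L[ℝ] ℝ).integral_comp_comm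
    (IsGaussian.integrable_id (μ := multivariateGaussian (0 : EuclideanSpace ℝ (Fin n)) K))
  simpa using this

lemma crossMoment_multivariateGaussian {K : Matrix (Fin n) (Fin n) ℝ} (hK : K.PosSemidef) :
    crossMoment (multivariateGaussian 0 K) WithLp.ofLp WithLp.ofLp = K := by
  ext i j
  rw [← covariance_eval_multivariateGaussian (μ := 0) hK i j,
    covariance_eq_sub (coordL2_multivariateGaussian K i) (coordL2_multivariateGaussian K j),
    integral_apply_multivariateGaussian]
  simp [crossMoment]

/-- The continuous linear map `(x, y) ↦ A x + B y`. -/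
noncomputable def linComb (A B : Matrix ι (Fin n) ℝ) :
    EuclideanSpace ℝ (Fin n) × EuclideanSpace ℝ (Fin n) →L[ℝ] ι → ℝ :=
  LinearMap.toContinuousLinearMap
    (A.mulVecLin ∘ₗ (WithLp.linearEquiv 2 ℝ (Fin n → ℝ)).toLinearMap ∘ₗ LinearMap.fst ℝ _ _ +
      B.mulVecLin ∘ₗ (WithLp.linearEquiv 2 ℝ (Fin n → ℝ)).toLinearMap ∘ₗ LinearMap.snd ℝ _ _)

lemma linComb_apply (A B : Matrix ι (Fin n) ℝ)
    (p : EuclideanSpace ℝ (Fin n) × EuclideanSpace ℝ (Fin n)) :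
    linComb A B p = A *ᵥ p.1.ofLp + B *ᵥ p.2.ofLp := rfl

variable {K₁ K₂ : Matrix (Fin n) (Fin n) ℝ}

lemma coordL2_linComb (A B : Matrix ι (Fin n) ℝ) :
    CoordL2 ((multivariateGaussian 0 K₁).prod (multivariateGaussian 0 K₂)) (linComb A B) :=
  fun i => IsGaussian.memLp_dual _ ((ContinuousLinearMap.proj i).comp (linComb A B)) 2 (by simp)

lemma integral_linComb (A B : Matrix ι (Fin n) ℝ) (i : ι) :
    ∫ p, linComb A B p i ∂((multivariateGaussian 0 K₁).prod (multivariateGaussian 0 K₂)) = 0 := by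
  have h1 : ∀ j, Integrable (fun x : EuclideanSpace ℝ (Fin n) => x.ofLp j)
      (multivariateGaussian 0 K₁) := fun j =>
    (coordL2_multivariateGaussian K₁ j).integrable (by simp)
  have h2 : ∀ j, Integrable (fun x : EuclideanSpace ℝ (Fin n) => x.ofLp j)
      (multivariateGaussian 0 K₂) := fun j =>
    (coordL2_multivariateGaussian K₂ j).integrable (by simp)
  simp only [linComb_apply, Pi.add_apply, Matrix.mulVec, dotProduct]
  rw [integral_add (integrable_finsetSum _ fun j _ => ((h1 j).comp_fst _).const_mul _)
      (integrable_finsetSum _ fun j _ => ((h2 j).comp_snd _).const_mul _),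
    integral_finsetSum _ fun j _ => ((h1 j).comp_fst _).const_mul _,
    integral_finsetSum _ fun j _ => ((h2 j).comp_snd _).const_mul _]
  simp only [integral_const_mul]
  have h3 : ∀ j, ∫ p : EuclideanSpace ℝ (Fin n) × EuclideanSpace ℝ (Fin n), p.1.ofLp j
      ∂((multivariateGaussian 0 K₁).prod (multivariateGaussian 0 K₂)) = 0 := fun j => by
    rw [integral_fun_fst (fun x : EuclideanSpace ℝ (Fin n) => x.ofLp j),
      integral_apply_multivariateGaussian]; simp
  have h4 : ∀ j, ∫ p : EuclideanSpace ℝ (Fin n) × EuclideanSpace ℝ (Fin n), p.2.ofLp j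
      ∂((multivariateGaussian 0 K₁).prod (multivariateGaussian 0 K₂)) = 0 := fun j => by
    rw [integral_fun_snd (fun x : EuclideanSpace ℝ (Fin n) => x.ofLp j),
      integral_apply_multivariateGaussian]; simp
  simp [h3, h4]

lemma crossMoment_linComb (h₁ : K₁.PosSemidef) (h₂ : K₂.PosSemidef) (A B : Matrix ι (Fin n) ℝ)
    (A' B' : Matrix κ (Fin n) ℝ) :
    crossMoment ((multivariateGaussian 0 K₁).prod (multivariateGaussian 0 K₂)) (linComb A B)
      (linComb A' B') = A * K₁ * A'ᵀ + B * K₂ * B'ᵀ := by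
  set γ := (multivariateGaussian (0 : EuclideanSpace ℝ (Fin n)) K₁).prod
    (multivariateGaussian (0 : EuclideanSpace ℝ (Fin n)) K₂)
  have hf : CoordL2 γ fun p => p.1.ofLp := fun i => (coordL2_multivariateGaussian K₁ i).comp_fst _
  have hs : CoordL2 γ fun p => p.2.ofLp := fun i => (coordL2_multivariateGaussian K₂ i).comp_snd _
  have h11 : crossMoment γ (fun p => p.1.ofLp) (fun p => p.1.ofLp) = K₁ := by
    rw [← crossMoment_multivariateGaussian h₁]
    exact crossMoment_map measurable_fst measurePreserving_fst.map_eq (by fun_prop) (by fun_prop)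
  have h22 : crossMoment γ (fun p => p.2.ofLp) (fun p => p.2.ofLp) = K₂ := by
    rw [← crossMoment_multivariateGaussian h₂]
    exact crossMoment_map measurable_snd measurePreserving_snd.map_eq (by fun_prop) (by fun_prop)
  have h12 : crossMoment γ (fun p => p.1.ofLp) (fun p => p.2.ofLp) = 0 := by
    ext i j
    simp only [crossMoment, Matrix.of_apply, Matrix.zero_apply, γ]
    rw [integral_prod_mul (fun x : EuclideanSpace ℝ (Fin n) => x.ofLp i)
      (fun x : EuclideanSpace ℝ (Fin n) => x.ofLp j), integral_apply_multivariateGaussian, zero_mul]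
  have h21 : crossMoment γ (fun p => p.2.ofLp) (fun p => p.1.ofLp) = 0 := by
    rw [← crossMoment_transpose, h12, Matrix.transpose_zero]
  change crossMoment γ (fun p => A *ᵥ p.1.ofLp + B *ᵥ p.2.ofLp)
    (fun p => A' *ᵥ p.1.ofLp + B' *ᵥ p.2.ofLp) = _
  have hR := (hf.mulVec A').add (hs.mulVec B')
  rw [crossMoment_add_left (hf.mulVec A) (hs.mulVec B) hR, crossMoment_mulVec_left hf hR,
    crossMoment_mulVec_left hs hR, crossMoment_add_right hf (hf.mulVec A') (hs.mulVec B'),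
    crossMoment_add_right hs (hf.mulVec A') (hs.mulVec B'), crossMoment_mulVec_right hf hf,
    crossMoment_mulVec_right hf hs, crossMoment_mulVec_right hs hf, crossMoment_mulVec_right hs hs,
    h11, h22, h12, h21]
  simp [Matrix.mul_assoc]

lemma covariance_linComb (h₁ : K₁.PosSemidef) (h₂ : K₂.PosSemidef) (A B : Matrix ι (Fin n) ℝ)
    (A' B' : Matrix κ (Fin n) ℝ) (i : ι) (j : κ) :
    cov[fun p => linComb A B p i, fun p => linComb A' B' p j;
      (multivariateGaussian 0 K₁).prod (multivariateGaussian 0 K₂)] =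
      (A * K₁ * A'ᵀ + B * K₂ * B'ᵀ) i j := by
  rw [covariance_eq_sub (coordL2_linComb A B i) (coordL2_linComb A' B' j), integral_linComb,
    ← crossMoment_linComb h₁ h₂]
  simp [crossMoment]

/-- Uncorrelated linear images of a pair of independent Gaussian vectors are independent. -/
lemma indepFun_linComb [Fintype ι] [Fintype κ] (h₁ : K₁.PosSemidef) (h₂ : K₂.PosSemidef)
    (A B : Matrix ι (Fin n) ℝ)
    (A' B' : Matrix κ (Fin n) ℝ) (h : A * K₁ * A'ᵀ + B * K₂ * B'ᵀ = 0) :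
    IndepFun (linComb A B) (linComb A' B')
      ((multivariateGaussian 0 K₁).prod (multivariateGaussian 0 K₂)) := by
  have hG : HasGaussianLaw (fun p => (linComb A B p, linComb A' B' p))
      ((multivariateGaussian 0 K₁).prod (multivariateGaussian 0 K₂)) :=
    (IsGaussian.hasGaussianLaw_id (μ := (multivariateGaussian (0 : EuclideanSpace ℝ (Fin n))
      K₁).prod (multivariateGaussian (0 : EuclideanSpace ℝ (Fin n)) K₂))).map_fun
      ((linComb A B).prod (linComb A' B'))
  refine HasGaussianLaw.indepFun_of_covariance_eval (X := fun i p => linComb A B p i)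
    (Y := fun j p => linComb A' B' p j) hG fun i j => ?_
  rw [covariance_linComb h₁ h₂, h]
  rfl

lemma map_linComb_apply (h₁ : K₁.PosSemidef) (h₂ : K₂.PosSemidef) (A B : Matrix ι (Fin n) ℝ)
    (i : ι) {v : ℝ≥0} (hv : (A * K₁ * Aᵀ + B * K₂ * Bᵀ) i i = v) :
    ((multivariateGaussian 0 K₁).prod (multivariateGaussian 0 K₂)).map
      (fun p => linComb A B p i) = gaussianReal 0 v := by
  have hG : HasGaussianLaw (fun p => linComb A B p i)
      ((multivariateGaussian 0 K₁).prod (multivariateGaussian 0 K₂)) :=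
    (IsGaussian.hasGaussianLaw_id (μ := (multivariateGaussian (0 : EuclideanSpace ℝ (Fin n))
      K₁).prod (multivariateGaussian (0 : EuclideanSpace ℝ (Fin n)) K₂))).map_fun
      ((ContinuousLinearMap.proj i).comp (linComb A B))
  rw [hG.map_eq_gaussianReal, integral_linComb, ← covariance_self
    ((coordL2_linComb A B i).aemeasurable), covariance_linComb h₁ h₂, hv, Real.toNNReal_coe]

/-- A linear image of a pair of independent Gaussian vectors is Gaussian. -/
lemma map_linComb (h₁ : K₁.PosSemidef) (h₂ : K₂.PosSemidef) (A B : Matrix (Fin n) (Fin n) ℝ) :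
    ((multivariateGaussian 0 K₁).prod (multivariateGaussian 0 K₂)).map
      (fun p => WithLp.toLp 2 (linComb A B p)) =
    multivariateGaussian 0 (A * K₁ * Aᵀ + B * K₂ * Bᵀ) := by
  set γ := (multivariateGaussian (0 : EuclideanSpace ℝ (Fin n)) K₁).prod
    (multivariateGaussian (0 : EuclideanSpace ℝ (Fin n)) K₂)
  set T : EuclideanSpace ℝ (Fin n) × EuclideanSpace ℝ (Fin n) →L[ℝ] EuclideanSpace ℝ (Fin n) :=
    ((PiLp.continuousLinearEquiv 2 ℝ (fun _ : Fin n => ℝ)).symm :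
      (Fin n → ℝ) →L[ℝ] EuclideanSpace ℝ (Fin n)).comp (linComb A B)
  change γ.map T = _
  have hK : (A * K₁ * Aᵀ + B * K₂ * Bᵀ).PosSemidef :=
    (posSemidef_mul_mul_transpose h₁ A).add (posSemidef_mul_mul_transpose h₂ B)
  have hT : ∀ p i, (T p).ofLp i = linComb A B p i := fun _ _ => rfl
  refine IsGaussian.ext ?_ ?_
  · rw [integral_id_multivariateGaussian', integral_map (by fun_prop) (by fun_prop)]
    simp only [id]
    ext i
    have := (EuclideanSpace.proj i : EuclideanSpace ℝ (Fin n) →L[ℝ] ℝ).integral_comp_comm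
      (φ := T) (μ := γ) (T.integrable_comp IsGaussian.integrable_id)
    exact this.symm.trans (integral_linComb A B i)
  · rw [← ContinuousLinearMap.toBilinForm_inj]
    refine LinearMap.BilinForm.ext_basis (EuclideanSpace.basisFun (Fin n) ℝ).toBasis fun i j => ?_
    rw [ContinuousLinearMap.toBilinForm_apply, ContinuousLinearMap.toBilinForm_apply,
      covarianceBilin_apply_eq_cov IsGaussian.memLp_two_id,
      covarianceBilin_apply_eq_cov IsGaussian.memLp_two_id, covariance_map (by fun_prop)
        (by fun_prop) (by fun_prop)]
    simp only [OrthonormalBasis.coe_toBasis, EuclideanSpace.basisFun_inner]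
    rw [covariance_eval_multivariateGaussian hK, ← covariance_linComb h₁ h₂]
    rfl

end Gaussian

/-! ### Adjoining an independent message -/

section Independence

/-- Independent functions of the noises stay independent when the message, which is independent
of the noises, is adjoined to one of them. -/
lemma indepFun_adjoin_fst {𝓜 Ω β γ : Type*} [MeasurableSpace 𝓜] [MeasurableSpace Ω]
    [MeasurableSpace β] [MeasurableSpace γ] (ν : Measure 𝓜) [IsProbabilityMeasure ν]
    {μ : Measure Ω} [IsProbabilityMeasure μ] {f : Ω → β} {g : Ω → γ} (hf : Measurable f)
    (hg : Measurable g) (h : IndepFun f g μ) :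
    IndepFun (fun p : 𝓜 × Ω => f p.2) (fun p : 𝓜 × Ω => (p.1, g p.2)) (ν.prod μ) := by
  rw [indepFun_iff_measure_inter_preimage_eq_mul] at h ⊢
  intro s t hs ht
  have hf' : Measurable fun p : 𝓜 × Ω => f p.2 := by fun_prop
  have hg' : Measurable fun p : 𝓜 × Ω => (p.1, g p.2) := by fun_prop
  rw [Measure.prod_apply ((hf' hs).inter (hg' ht)), Measure.prod_apply (hf' hs),
    Measure.prod_apply (hg' ht)]
  have h1 : ∀ m, μ (Prod.mk m ⁻¹' ((fun p : 𝓜 × Ω => f p.2) ⁻¹' s ∩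
      (fun p : 𝓜 × Ω => (p.1, g p.2)) ⁻¹' t)) =
      μ (f ⁻¹' s) * μ (Prod.mk m ⁻¹' ((fun p : 𝓜 × Ω => (p.1, g p.2)) ⁻¹' t)) := fun m =>
    h s (Prod.mk m ⁻¹' t) hs (measurable_prodMk_left ht)
  have h2 : ∀ m, μ (Prod.mk m ⁻¹' ((fun p : 𝓜 × Ω => f p.2) ⁻¹' s)) = μ (f ⁻¹' s) := fun m => rfl
  simp only [h1, h2]
  rw [lintegral_const_mul _ (measurable_measure_prodMk_left (hg' ht))]
  simp

lemma map_prod_snd {𝓜 Ω β : Type*} [MeasurableSpace 𝓜] [MeasurableSpace Ω]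
    [MeasurableSpace β] (ν : Measure 𝓜) [IsProbabilityMeasure ν]
    {μ : Measure Ω} [IsProbabilityMeasure μ] {f : Ω → β} (hf : Measurable f) :
    (ν.prod μ).map (fun p => f p.2) = μ.map f := by
  rw [← Function.comp_def, ← Measure.map_map hf measurable_snd, ← Measure.snd, Measure.snd_prod]

end Independence

end NoisyFeedback

namespace NoisyFeedback

variable {n : ℕ} {𝓜 : Type} [MeasurableSpace 𝓜]

/-! ### Causal form of the inputs -/

namespace FeedbackCode

/-- The `i`-th input as a function of the message and of the total noises
`uⱼ = wⱼ + vⱼ`, `j < i`. -/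
def causalInput (c : FeedbackCode n 𝓜) (i : Fin n) (m : 𝓜) (u : {j : Fin n // j < i} → ℝ) : ℝ :=
  c.enc i m fun j => c.causalInput j.1 m (fun k => u ⟨k.1, k.2.trans j.2⟩) + u j
termination_by i
decreasing_by exact j.2

/-- The recursion meets the noises only through `wⱼ + vⱼ` with `j < i`. Causality enters every
independence argument through this form of the inputs. -/
lemma input_eq_causalInput (c : FeedbackCode n 𝓜) (m : 𝓜) (w v : EuclideanSpace ℝ (Fin n))
    (i : Fin n) : c.input m w v i = c.causalInput i m fun j => w j + v j := by
  induction i using WellFoundedLT.induction with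
  | ind i ih =>
    rw [input, causalInput]
    congr 1
    funext j
    rw [ih j.1 j.2, add_assoc]

lemma measurable_causalInput (c : FeedbackCode n 𝓜) (i : Fin n) :
    Measurable fun p : 𝓜 × ({j : Fin n // j < i} → ℝ) => c.causalInput i p.1 p.2 := by
  induction i using WellFoundedLT.induction with
  | ind i ih =>
    have h : (fun p : 𝓜 × ({j : Fin n // j < i} → ℝ) => c.causalInput i p.1 p.2) =
        fun p => Function.uncurry (c.enc i) (p.1, fun j : {j : Fin n // j < i} =>
          c.causalInput j.1 p.1 (fun k => p.2 ⟨k.1, k.2.trans j.2⟩) + p.2 j) := by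
      funext p
      rw [causalInput]
      rfl
    rw [h]
    refine (c.measurable_enc i).comp (measurable_fst.prodMk (measurable_pi_lambda _ fun j => ?_))
    refine Measurable.add ?_ (by fun_prop)
    exact (ih j.1 j.2).comp (g := fun p : 𝓜 × ({k : Fin n // k < j.1} → ℝ) =>
      c.causalInput j.1 p.1 p.2) (f := fun p : 𝓜 × ({j : Fin n // j < i} → ℝ) =>
        (p.1, fun k : {k : Fin n // k < j.1} => p.2 ⟨k.1, k.2.trans j.2⟩)) (by fun_prop)

/-- The channel input as a random vector. -/
def inputVec (c : FeedbackCode n 𝓜)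
    (p : 𝓜 × EuclideanSpace ℝ (Fin n) × EuclideanSpace ℝ (Fin n)) : Fin n → ℝ :=
  fun i => c.input p.1 p.2.1 p.2.2 i

lemma measurable_inputVec (c : FeedbackCode n 𝓜) : Measurable c.inputVec := by
  refine measurable_pi_lambda _ fun i => ?_
  have : (fun p => c.inputVec p i) = (fun p : 𝓜 × ({j : Fin n // j < i} → ℝ) =>
      c.causalInput i p.1 p.2) ∘ fun p => (p.1, fun j : {j : Fin n // j < i} =>
        p.2.1.ofLp j + p.2.2.ofLp j) := by
    funext p
    exact c.input_eq_causalInput _ _ _ _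
  rw [this]
  exact (c.measurable_causalInput i).comp (by fun_prop)

end FeedbackCode

/-! ### Independence of the noise innovations -/

section NoiseIndependence

variable {Kw Kv : Matrix (Fin n) (Fin n) ℝ}

lemma unitLower_mulVec {L : Matrix (Fin n) (Fin n) ℝ} (h1 : ∀ i, L i i = 1)
    (h0 : ∀ i j, i < j → L i j = 0) (x : Fin n → ℝ) (i : Fin n) :
    (L *ᵥ x) i = x i + ∑ j : {j : Fin n // j < i}, L i j * x j := by
  have hs := Finset.sum_subtype (p := fun j => j < i) (F := inferInstance)
    (Finset.univ.filter (· < i)) (by simp) (fun j => L i j * x j)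
  rw [← hs, Matrix.mulVec, dotProduct,
    ← Finset.sum_filter_not_add_sum_filter Finset.univ (· < i)]
  congr 1
  rw [Finset.sum_eq_single i]
  · simp [h1]
  · intro j hj hji
    have : i < j := lt_of_le_of_ne (by simpa using hj) (Ne.symm hji)
    simp [h0 i j this]
  · simp

/-- The noise law. -/
noncomputable abbrev noiseLaw (Kw Kv : Matrix (Fin n) (Fin n) ℝ) :
    Measure (EuclideanSpace ℝ (Fin n) × EuclideanSpace ℝ (Fin n)) :=
  (multivariateGaussian 0 Kw).prod (multivariateGaussian 0 Kv)

/-- The coordinate projection to the indices below `i`, as a matrix. -/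
def pastMatrix (i : Fin n) : Matrix {j : Fin n // j < i} (Fin n) ℝ :=
  (1 : Matrix (Fin n) (Fin n) ℝ).submatrix Subtype.val id

lemma pastMatrix_mulVec (i : Fin n) (x : Fin n → ℝ) (j : {j : Fin n // j < i}) :
    (pastMatrix i *ᵥ x) j = x j := by
  have : (pastMatrix i *ᵥ x) j = ((1 : Matrix (Fin n) (Fin n) ℝ) *ᵥ x) j := rfl
  rw [this, Matrix.one_mulVec]

lemma mul_pastMatrix_transpose {ι : Type*} (i : Fin n) (A : Matrix ι (Fin n) ℝ) (k : ι)
    (j : {j : Fin n // j < i}) : (A * (pastMatrix i)ᵀ) k j = A k j := by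
  have : (A * (pastMatrix i)ᵀ) k j = (A * (1 : Matrix (Fin n) (Fin n) ℝ)ᵀ) k j := rfl
  rw [this, Matrix.transpose_one, Matrix.mul_one]

/-- The innovations of the first vector are independent of its past and of the second vector. -/
lemma indepFun_innovation_fst (hKw : Kw.PosSemidef) (hKv : Kv.PosSemidef)
    {L : Matrix (Fin n) (Fin n) ℝ} {d : Fin n → ℝ≥0} (hL : IsUnitLDL Kw L d) (i : Fin n) :
    IndepFun (fun p => (L *ᵥ p.1.ofLp) i)
      (fun p => (fun j : {j : Fin n // j < i} => p.1.ofLp j, p.2.ofLp)) (noiseLaw Kw Kv) := by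
  have h := indepFun_linComb hKw hKv (L.submatrix (fun _ : Unit => i) id) 0
    (Matrix.fromRows (pastMatrix i) 0) (Matrix.fromRows 0 (1 : Matrix (Fin n) (Fin n) ℝ)) (by
      ext k j
      rw [Matrix.zero_mul, Matrix.zero_mul, add_zero, Matrix.transpose_fromRows,
        Matrix.mul_fromCols]
      rcases j with j | j
      · rw [Matrix.fromCols_apply_inl, mul_pastMatrix_transpose]
        exact hL.mul_apply_eq_zero j.2
      · simp)
  have hev : Measurable fun x : Unit → ℝ => x () := measurable_pi_apply ()
  have h' := h.comp (φ := fun x : Unit → ℝ => x ())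
    (ψ := fun y : {j : Fin n // j < i} ⊕ Fin n → ℝ => (fun j => y (Sum.inl j),
    fun j => y (Sum.inr j))) hev (by fun_prop)
  convert h' using 1
  · funext p
    simp only [Function.comp, linComb_apply, Matrix.zero_mulVec, add_zero]
    rfl
  · funext p
    simp only [Function.comp, linComb_apply, Matrix.fromRows_mulVec, Matrix.zero_mulVec,
      Matrix.one_mulVec, Pi.add_apply, Sum.elim_inl, Sum.elim_inr, pastMatrix_mulVec,
      Pi.zero_apply, add_zero, zero_add]

/-- The innovations of the sum of the two vectors are independent of its past. -/
lemma indepFun_innovation_add (hKw : Kw.PosSemidef) (hKv : Kv.PosSemidef)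
    {L : Matrix (Fin n) (Fin n) ℝ} {d : Fin n → ℝ≥0} (hL : IsUnitLDL (Kv + Kw) L d) (i : Fin n) :
    IndepFun (fun p => (L *ᵥ (p.1.ofLp + p.2.ofLp)) i)
      (fun p => fun j : {j : Fin n // j < i} => p.1.ofLp j + p.2.ofLp j) (noiseLaw Kw Kv) := by
  have h := indepFun_linComb hKw hKv (L.submatrix (fun _ : Unit => i) id)
    (L.submatrix (fun _ : Unit => i) id) (pastMatrix i) (pastMatrix i) (by
      ext k j
      rw [← Matrix.add_mul, ← Matrix.mul_add, add_comm, mul_pastMatrix_transpose]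
      exact hL.mul_apply_eq_zero j.2)
  have hev : Measurable fun x : Unit → ℝ => x () := measurable_pi_apply ()
  have h' := h.comp (φ := fun x : Unit → ℝ => x ()) (ψ := id) hev measurable_id
  convert h' using 1
  · funext p
    simp only [Function.comp, linComb_apply, ← Matrix.mulVec_add]
    rfl
  · funext p
    simp only [Function.comp, linComb_apply, id]
    funext j
    rw [Pi.add_apply, pastMatrix_mulVec, pastMatrix_mulVec]

/-- The first vector minus its linear estimate from the sum is independent of the sum. -/
lemma indepFun_residual_add (hKw : Kw.PosDef) (hKv : Kv.PosSemidef) :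
    IndepFun (fun p => p.1.ofLp - (Kw * (Kv + Kw)⁻¹) *ᵥ (p.1.ofLp + p.2.ofLp))
      (fun p => p.1.ofLp + p.2.ofLp) (noiseLaw Kw Kv) := by
  have hu : IsUnit (Kv + Kw).det :=
    (Matrix.isUnit_iff_isUnit_det _).1 (Matrix.PosDef.posSemidef_add hKv hKw).isUnit
  have h := indepFun_linComb hKw.posSemidef hKv (1 - Kw * (Kv + Kw)⁻¹) (-(Kw * (Kv + Kw)⁻¹)) 1 1 (by
    rw [Matrix.transpose_one, Matrix.mul_one, Matrix.mul_one, Matrix.sub_mul, Matrix.one_mul,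
      Matrix.neg_mul, ← sub_eq_add_neg, sub_sub, ← Matrix.mul_add, add_comm Kw Kv,
      Matrix.nonsing_inv_mul_cancel_right _ _ hu, sub_self])
  convert h using 1
  · funext p
    simp only [linComb_apply, Matrix.sub_mulVec, Matrix.one_mulVec, Matrix.neg_mulVec,
      Matrix.mulVec_add]
    abel
  · funext p
    simp [linComb_apply]

lemma map_innovation_fst (hKw : Kw.PosSemidef) (hKv : Kv.PosSemidef)
    {L : Matrix (Fin n) (Fin n) ℝ} {d : Fin n → ℝ≥0} (hL : IsUnitLDL Kw L d) (i : Fin n) :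
    (noiseLaw Kw Kv).map (fun p => (L *ᵥ p.1.ofLp) i) = gaussianReal 0 (d i) := by
  have h := map_linComb_apply hKw hKv L 0 i (v := d i) (by simp [hL.conj])
  convert h using 2
  funext p
  simp [linComb_apply]

end NoiseIndependence

end NoisyFeedback

namespace NoisyFeedback

variable {n : ℕ} {𝓜 : Type} [MeasurableSpace 𝓜]

/-! ### The Gaussian reference law -/

section Reference

/-- The linear prediction of the `i`-th output from the past outputs and from the feedback noise,
when the outputs corrected by `B v` have innovations `L (y - B v)`. -/
def refMean (B L : Matrix (Fin n) (Fin n) ℝ) (i : Fin n)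
    (z : ({j : Fin n // j < i} → ℝ) × (Fin n → ℝ)) : ℝ :=
  (B *ᵥ z.2) i - ∑ j : {j : Fin n // j < i}, L i j * (z.1 j - (B *ᵥ z.2) j)

lemma measurable_refMean (B L : Matrix (Fin n) (Fin n) ℝ) (i : Fin n) :
    Measurable (refMean B L i) := by
  unfold refMean
  simp only [Matrix.mulVec, dotProduct]
  fun_prop

/-- Since `L` has unit diagonal, the error of the predictor is the innovation of the corrected
vector `y - B v`; its mean square is therefore a diagonal entry of a congruence by `L`. -/
lemma sub_refMean {B L : Matrix (Fin n) (Fin n) ℝ} (h1 : ∀ i, L i i = 1)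
    (h0 : ∀ i j, i < j → L i j = 0) (y v : Fin n → ℝ) (i : Fin n) :
    y i - refMean B L i (fun j => y j, v) = (L *ᵥ (y - B *ᵥ v)) i := by
  rw [unitLower_mulVec h1 h0, refMean]
  simp only [Pi.sub_apply]
  ring

end Reference

/-! ### The terms of the directed information -/

namespace FeedbackCode

/-- The channel output as a random vector. -/
def outputVec (c : FeedbackCode n 𝓜)
    (p : 𝓜 × EuclideanSpace ℝ (Fin n) × EuclideanSpace ℝ (Fin n)) : Fin n → ℝ :=
  c.inputVec p + p.2.1.ofLp

lemma measurable_outputVec (c : FeedbackCode n 𝓜) : Measurable c.outputVec :=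
  c.measurable_inputVec.add (by fun_prop)

/-- The past outputs together with the whole feedback noise. -/
def sideInfo (c : FeedbackCode n 𝓜) (i : Fin n)
    (p : 𝓜 × EuclideanSpace ℝ (Fin n) × EuclideanSpace ℝ (Fin n)) :
    ({j : Fin n // j < i} → ℝ) × (Fin n → ℝ) :=
  (fun j => c.outputVec p j, p.2.2.ofLp)

lemma measurable_sideInfo (c : FeedbackCode n 𝓜) (i : Fin n) : Measurable (c.sideInfo i) := by
  have := c.measurable_outputVec
  unfold sideInfo
  fun_prop

/-- The inputs up to time `i`. -/
def inputUpTo (c : FeedbackCode n 𝓜) (i : Fin n)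
    (p : 𝓜 × EuclideanSpace ℝ (Fin n) × EuclideanSpace ℝ (Fin n)) :
    {j : Fin n // j ≤ i} → ℝ := fun j => c.inputVec p j

lemma measurable_inputUpTo (c : FeedbackCode n 𝓜) (i : Fin n) : Measurable (c.inputUpTo i) := by
  have := c.measurable_inputVec
  unfold inputUpTo
  fun_prop

variable (c : FeedbackCode n 𝓜) (Kw Kv : Matrix (Fin n) (Fin n) ℝ)

/-- The `i`-th term `I(Xⁱ; Yᵢ | Yⁱ⁻¹, Vⁿ)` of the directed information, in nats. -/
noncomputable def stepInfo (i : Fin n) : ℝ≥0∞ :=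
  klDiv ((c.jointLaw Kw Kv).map fun p => (c.sideInfo i p, c.inputUpTo i p, c.outputVec p i))
    (((c.jointLaw Kw Kv).map (c.sideInfo i)) ⊗ₘ
      (condDistrib (c.inputUpTo i) (c.sideInfo i) (c.jointLaw Kw Kv) ×ₖ
        condDistrib (fun p => c.outputVec p i) (c.sideInfo i) (c.jointLaw Kw Kv)))

/-- The law of the side information and of the output at time `i`. -/
noncomputable def sideOutputLaw (i : Fin n) :
    Measure ((({j : Fin n // j < i} → ℝ) × (Fin n → ℝ)) × ℝ) :=
  (c.jointLaw Kw Kv).map fun p => (c.sideInfo i p, c.outputVec p i)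

lemma rate_eq : c.rate Kw Kv = (∑ i, c.stepInfo Kw Kv i) / ENNReal.ofReal (Real.log 2) / n := by
  unfold rate directedInfo condMutualInfo
  simp only [div_eq_mul_inv, Finset.sum_mul]
  rfl

/-- The channel innovation at time `i` is independent of the side information and the inputs. -/
lemma indepFun_innovation (hKw : Kw.PosSemidef) (hKv : Kv.PosSemidef)
    {Lw : Matrix (Fin n) (Fin n) ℝ} {s : Fin n → ℝ≥0} (hw : IsUnitLDL Kw Lw s) (i : Fin n) :
    IndepFun (fun p => (Lw *ᵥ p.2.1.ofLp) i) (fun p => (c.sideInfo i p, c.inputUpTo i p))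
      (c.jointLaw Kw Kv) := by
  have h := indepFun_adjoin_fst c.law (f := fun p : EuclideanSpace ℝ (Fin n) ×
      EuclideanSpace ℝ (Fin n) => (Lw *ᵥ p.1.ofLp) i)
    (by simp only [Matrix.mulVec, dotProduct]; fun_prop) (by fun_prop)
    (indepFun_innovation_fst hKw hKv hw i)
  -- The inputs up to time `i` involve the message, the feedback noise and only the channel noises
  -- strictly before `i`, all independent of the `i`-th channel innovation.
  set X : 𝓜 × ({j : Fin n // j < i} → ℝ) × (Fin n → ℝ) → {j : Fin n // j ≤ i} → ℝ :=
    fun q j => c.causalInput j q.1 fun k => q.2.1 ⟨k.1, k.2.trans_le j.2⟩ + q.2.2 k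
  have hX : Measurable X := by
    refine measurable_pi_lambda _ fun j => ?_
    exact (c.measurable_causalInput j.1).comp
      (f := fun q : 𝓜 × ({j : Fin n // j < i} → ℝ) × (Fin n → ℝ) =>
        (q.1, fun k : {k : Fin n // k < j.1} => q.2.1 ⟨k.1, k.2.trans_le j.2⟩ + q.2.2 k))
      (by fun_prop)
  have h' := h.comp (φ := id) (ψ := fun q =>
      (((fun j => X q ⟨j.1, j.2.le⟩ + q.2.1 j, q.2.2) :
        ({j : Fin n // j < i} → ℝ) × (Fin n → ℝ)), X q)) measurable_id (by fun_prop)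
  convert! h' using 1
  funext p
  have hXp : ∀ j : {j : Fin n // j ≤ i}, c.inputVec p j =
      X (p.1, (fun j : {j : Fin n // j < i} => p.2.1.ofLp j), p.2.2.ofLp) j := fun j =>
    c.input_eq_causalInput _ _ _ _
  refine Prod.ext (Prod.ext ?_ rfl) ?_
  · funext j
    exact congrArg (· + p.2.1.ofLp j) (hXp ⟨j.1, j.2.le⟩)
  · funext j
    exact hXp j

lemma map_noise {β : Type*} [MeasurableSpace β]
    {f : EuclideanSpace ℝ (Fin n) × EuclideanSpace ℝ (Fin n) → β} (hf : Measurable f) :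
    (c.jointLaw Kw Kv).map (fun p => f p.2) = (noiseLaw Kw Kv).map f :=
  map_prod_snd c.law hf

lemma coordL2_fst_noise : CoordL2 (c.jointLaw Kw Kv) fun p => p.2.1.ofLp := fun i =>
  ((coordL2_multivariateGaussian Kw i).comp_fst _).comp_snd _

lemma coordL2_snd_noise : CoordL2 (c.jointLaw Kw Kv) fun p => p.2.2.ofLp := fun i =>
  ((coordL2_multivariateGaussian Kv i).comp_snd _).comp_snd _

variable {c Kw Kv}

lemma coordL2_corrected (hX : CoordL2 (c.jointLaw Kw Kv) c.inputVec)
    (B : Matrix (Fin n) (Fin n) ℝ) :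
    CoordL2 (c.jointLaw Kw Kv) fun p => c.outputVec p - B *ᵥ p.2.2.ofLp :=
  (hX.add (c.coordL2_fst_noise Kw Kv)).sub ((c.coordL2_snd_noise Kw Kv).mulVec B)

/-- The `i`-th term of the directed information, compared with a Gaussian reference law of the
output given the side information. -/
lemma stepInfo_add_klDiv (hKw : Kw.PosSemidef) (hKv : Kv.PosSemidef)
    (hX : CoordL2 (c.jointLaw Kw Kv) c.inputVec)
    {Lw : Matrix (Fin n) (Fin n) ℝ} {s : Fin n → ℝ≥0} (hw : IsUnitLDL Kw Lw s)
    {K L : Matrix (Fin n) (Fin n) ℝ} {d : Fin n → ℝ≥0} (hL : IsUnitLDL K L d)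
    (B : Matrix (Fin n) (Fin n) ℝ) (i : Fin n) :
    0 ≤ 1 / 2 * Real.log (d i / s i) + (L * crossMoment (c.jointLaw Kw Kv)
        (fun p => c.outputVec p - B *ᵥ p.2.2.ofLp) (fun p => c.outputVec p - B *ᵥ p.2.2.ofLp) *
          Lᵀ) i i / (2 * d i) - 1 / 2 ∧
    c.stepInfo Kw Kv i + klDiv (c.sideOutputLaw Kw Kv i)
      ((c.jointLaw Kw Kv).map (c.sideInfo i) ⊗ₘ
        gaussianKernel (refMean B L i) (measurable_refMean B L i) (d i)) =
    ENNReal.ofReal (1 / 2 * Real.log (d i / s i) + (L * crossMoment (c.jointLaw Kw Kv)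
        (fun p => c.outputVec p - B *ᵥ p.2.2.ofLp) (fun p => c.outputVec p - B *ᵥ p.2.2.ofLp) *
          Lᵀ) i i / (2 * d i) - 1 / 2) := by
  have hY := coordL2_corrected hX B
  have hres : ∀ p, c.outputVec p i - refMean B L i (c.sideInfo i p) =
      (L *ᵥ (c.outputVec p - B *ᵥ p.2.2.ofLp)) i := fun p =>
    sub_refMean hL.diag_eq_one hL.lower _ _ i
  have hint : ∫ p, (c.outputVec p i - refMean B L i (c.sideInfo i p)) ^ 2 ∂(c.jointLaw Kw Kv) =
      (L * crossMoment (c.jointLaw Kw Kv) (fun p => c.outputVec p - B *ᵥ p.2.2.ofLp)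
        (fun p => c.outputVec p - B *ᵥ p.2.2.ofLp) * Lᵀ) i i := by
    rw [← crossMoment_mulVec_left hY hY, ← crossMoment_mulVec_right (hY.mulVec L) hY]
    simp only [hres, sq]
    rfl
  have hmY : Measurable fun p => c.outputVec p i := (measurable_pi_apply i).comp
    c.measurable_outputVec
  have hmN : Measurable fun p : EuclideanSpace ℝ (Fin n) × EuclideanSpace ℝ (Fin n) =>
      (Lw *ᵥ p.1.ofLp) i := by
    simp only [Matrix.mulVec, dotProduct]; fun_prop
  have key := klDiv_add_klDiv_gaussian (μ := c.jointLaw Kw Kv) (X := c.inputUpTo i)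
    (Y := fun p => c.outputVec p i) (Z := c.sideInfo i) (N := fun p => (Lw *ᵥ p.2.1.ofLp) i)
    (c.measurable_inputUpTo i) hmY (c.measurable_sideInfo i) (hmN.comp measurable_snd)
    -- Inputs and past outputs together reveal the past channel noise `Wⱼ = Yⱼ - Xⱼ`, so only the
    -- innovation of `Wᵢ` remains random in `Yᵢ`.
    (f := fun q => q.2 ⟨i, le_rfl⟩ - ∑ j : {j : Fin n // j < i},
      Lw i j * (q.1.1 j - q.2 ⟨j.1, j.2.le⟩)) (by fun_prop)
    (fun p => by
      rw [unitLower_mulVec hw.diag_eq_one hw.lower]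
      simp only [sideInfo, inputUpTo, outputVec, Pi.add_apply, add_sub_cancel_left]
      ring)
    (measurable_refMean B L i) (hw.ne_zero i) (hL.ne_zero i)
    ((c.map_noise Kw Kv hmN).trans (map_innovation_fst hKw hKv hw i))
    (c.indepFun_innovation Kw Kv hKw hKv hw i)
    (by
      simp only [hres]
      exact hY.mulVec L i)
  rw [hint] at key
  exact key

end FeedbackCode

end NoisyFeedback

namespace NoisyFeedback

variable {n : ℕ} {𝓜 : Type} [MeasurableSpace 𝓜]

/-! ### Converse: the rate of every scheme is at most an objective value -/

namespace FeedbackCode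

variable {c : FeedbackCode n 𝓜} {Kw Kv : Matrix (Fin n) (Fin n) ℝ}

/-- The power is defined by a lower integral, so a finite bound already forces square integrability
and the constraint can be read in real second moments. -/
lemma meetsPower_iff (hn : 0 < n) {P : ℝ} (hP : 0 ≤ P) :
    c.MeetsPower Kw Kv P ↔ CoordL2 (c.jointLaw Kw Kv) c.inputVec ∧
      (crossMoment (c.jointLaw Kw Kv) c.inputVec c.inputVec).trace ≤ n * P := by
  have hm : ∀ i, Measurable fun p => c.inputVec p i := fun i =>
    (measurable_pi_apply i).comp c.measurable_inputVec
  have hn0 : (n : ℝ≥0∞) ≠ 0 := by exact_mod_cast hn.ne'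
  have hpow : c.MeetsPower Kw Kv P ↔ ∑ i, ∫⁻ p, ENNReal.ofReal (c.inputVec p i ^ 2)
      ∂(c.jointLaw Kw Kv) ≤ ENNReal.ofReal (n * P) := by
    unfold MeetsPower
    rw [ENNReal.div_le_iff hn0 (by simp), ENNReal.ofReal_mul (by positivity),
      ENNReal.ofReal_natCast, mul_comm]
    rfl
  have hL2 : CoordL2 (c.jointLaw Kw Kv) c.inputVec →
      ∑ i, ∫⁻ p, ENNReal.ofReal (c.inputVec p i ^ 2) ∂(c.jointLaw Kw Kv) =
        ENNReal.ofReal (crossMoment (c.jointLaw Kw Kv) c.inputVec c.inputVec).trace := by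
    intro h
    rw [Matrix.trace, ENNReal.ofReal_sum_of_nonneg]
    · refine Finset.sum_congr rfl fun i _ => ?_
      rw [← ofReal_integral_eq_lintegral_ofReal (h i).integrable_sq
        (Filter.Eventually.of_forall fun p => sq_nonneg _)]
      simp only [sq]
      rfl
    · exact fun i _ => integral_nonneg fun p => mul_self_nonneg _
  rw [hpow]
  constructor
  · intro h
    have h2 : CoordL2 (c.jointLaw Kw Kv) c.inputVec := fun i => by
      rw [memLp_two_iff_integrable_sq (hm i).aestronglyMeasurable]
      refine ⟨((hm i).pow_const 2).aestronglyMeasurable, ?_⟩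
      rw [hasFiniteIntegral_iff_ofReal (Filter.Eventually.of_forall fun p => sq_nonneg _)]
      refine lt_of_le_of_lt ?_ (h.trans_lt ENNReal.ofReal_lt_top)
      exact Finset.single_le_sum (f := fun i => ∫⁻ p, ENNReal.ofReal (c.inputVec p i ^ 2)
        ∂(c.jointLaw Kw Kv)) (fun _ _ => zero_le) (Finset.mem_univ i)
    refine ⟨h2, ?_⟩
    rwa [hL2 h2, ENNReal.ofReal_le_ofReal_iff (by positivity)] at h
  · rintro ⟨h2, h⟩
    rw [hL2 h2]
    exact ENNReal.ofReal_le_ofReal h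

/-- The total noise `Wⁿ + Vⁿ` seen by the feedback link. -/
def totalNoise (p : 𝓜 × EuclideanSpace ℝ (Fin n) × EuclideanSpace ℝ (Fin n)) : Fin n → ℝ :=
  p.2.1.ofLp + p.2.2.ofLp

lemma coordL2_totalNoise : CoordL2 (c.jointLaw Kw Kv) totalNoise :=
  (c.coordL2_fst_noise Kw Kv).add (c.coordL2_snd_noise Kw Kv)

lemma crossMoment_noise (hKw : Kw.PosSemidef) (hKv : Kv.PosSemidef)
    (A B A' B' : Matrix (Fin n) (Fin n) ℝ) :
    crossMoment (c.jointLaw Kw Kv) (fun p => A *ᵥ p.2.1.ofLp + B *ᵥ p.2.2.ofLp)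
      (fun p => A' *ᵥ p.2.1.ofLp + B' *ᵥ p.2.2.ofLp) = A * Kw * A'ᵀ + B * Kv * B'ᵀ := by
  rw [← crossMoment_linComb hKw hKv]
  have hT : (c.jointLaw Kw Kv).map Prod.snd = noiseLaw Kw Kv := measurePreserving_snd.map_eq
  refine crossMoment_map (F := fun q => linComb A B q) (G := fun q => linComb A' B' q)
    measurable_snd hT ?_ ?_ <;>
  · intro i
    exact (measurable_pi_apply i).comp (ContinuousLinearMap.measurable _)

lemma crossMoment_fst_noise (hKw : Kw.PosSemidef) (hKv : Kv.PosSemidef) :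
    crossMoment (c.jointLaw Kw Kv) (fun p => p.2.1.ofLp) (fun p => p.2.1.ofLp) = Kw := by
  have := crossMoment_noise (c := c) hKw hKv 1 0 1 0
  simpa using this

lemma crossMoment_totalNoise (hKw : Kw.PosSemidef) (hKv : Kv.PosSemidef) :
    crossMoment (c.jointLaw Kw Kv) totalNoise totalNoise = Kv + Kw := by
  have := crossMoment_noise (c := c) hKw hKv 1 1 1 1
  rw [add_comm]
  change crossMoment (c.jointLaw Kw Kv) (fun p => p.2.1.ofLp + p.2.2.ofLp)
    (fun p => p.2.1.ofLp + p.2.2.ofLp) = _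
  simpa using this

/-- Second moments for an input `Xⁿ = Sⁿ + B (Wⁿ + Vⁿ)` with `Sⁿ` orthogonal to the noises. -/
lemma crossMoment_of_orthogonal (hKw : Kw.PosSemidef) (hKv : Kv.PosSemidef)
    {B : Matrix (Fin n) (Fin n) ℝ}
    {S : 𝓜 × EuclideanSpace ℝ (Fin n) × EuclideanSpace ℝ (Fin n) → Fin n → ℝ}
    (hS : CoordL2 (c.jointLaw Kw Kv) S) (hX : ∀ p, c.inputVec p = S p + B *ᵥ totalNoise p)
    (hSW : crossMoment (c.jointLaw Kw Kv) S (fun p => p.2.1.ofLp) = 0)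
    (hSU : crossMoment (c.jointLaw Kw Kv) S totalNoise = 0) :
    crossMoment (c.jointLaw Kw Kv) c.inputVec c.inputVec =
      crossMoment (c.jointLaw Kw Kv) S S + B * (Kv + Kw) * Bᵀ ∧
    crossMoment (c.jointLaw Kw Kv) (fun p => c.outputVec p - B *ᵥ p.2.2.ofLp)
        (fun p => c.outputVec p - B *ᵥ p.2.2.ofLp) =
      (1 + B) * Kw * (1 + B)ᵀ + crossMoment (c.jointLaw Kw Kv) S S := by
  have gen : ∀ {G : 𝓜 × EuclideanSpace ℝ (Fin n) × EuclideanSpace ℝ (Fin n) → Fin n → ℝ}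
      (_ : CoordL2 (c.jointLaw Kw Kv) G) (_ : crossMoment (c.jointLaw Kw Kv) S G = 0)
      (A : Matrix (Fin n) (Fin n) ℝ), crossMoment (c.jointLaw Kw Kv) (fun p => S p + A *ᵥ G p)
        (fun p => S p + A *ᵥ G p) = crossMoment (c.jointLaw Kw Kv) S S +
          A * crossMoment (c.jointLaw Kw Kv) G G * Aᵀ := by
    intro G hG hSG A
    have hGS : crossMoment (c.jointLaw Kw Kv) G S = 0 := by
      rw [← crossMoment_transpose, hSG, Matrix.transpose_zero]
    have hR := hS.add (hG.mulVec A)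
    rw [crossMoment_add_left hS (hG.mulVec A) hR, crossMoment_mulVec_left hG hR,
      crossMoment_add_right hS hS (hG.mulVec A), crossMoment_add_right hG hS (hG.mulVec A),
      crossMoment_mulVec_right hS hG, crossMoment_mulVec_right hG hG, hSG, hGS]
    simp [Matrix.mul_assoc]
  constructor
  · have h := gen coordL2_totalNoise hSU B
    rw [crossMoment_totalNoise hKw hKv] at h
    rw [← h, funext hX]
  · have h := gen (c.coordL2_fst_noise Kw Kv) hSW (1 + B)
    rw [crossMoment_fst_noise hKw hKv] at h
    rw [add_comm, ← h]
    have : ∀ p, c.outputVec p - B *ᵥ p.2.2.ofLp = S p + (1 + B) *ᵥ p.2.1.ofLp := fun p => by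
      rw [outputVec, hX, totalNoise, Matrix.mulVec_add, Matrix.add_mulVec, Matrix.one_mulVec]
      abel
    simp only [this]

lemma integral_noise_eq_zero (A B : Matrix (Fin n) (Fin n) ℝ) (i : Fin n) :
    ∫ p, (A *ᵥ p.2.1.ofLp + B *ᵥ p.2.2.ofLp) i ∂(c.jointLaw Kw Kv) = 0 := by
  have h : ∫ p, linComb A B p i ∂(noiseLaw Kw Kv) = 0 := integral_linComb A B i
  have hm : Measurable fun p => linComb A B p i :=
    (measurable_pi_apply i).comp (ContinuousLinearMap.measurable _)
  have hT : (c.jointLaw Kw Kv).map Prod.snd = noiseLaw Kw Kv := measurePreserving_snd.map_eq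
  rw [← hT, integral_map (by fun_prop) hm.aestronglyMeasurable] at h
  exact h

/-- Linear estimation of the inputs from the total noise splits every scheme into a signal
orthogonal to the noises and a strictly causal linear feedback term. -/
lemma exists_feasible_of_meetsPower (hn : 0 < n) (hKw : Kw.PosDef) (hKv : Kv.PosSemidef)
    {P : ℝ} (hP : 0 ≤ P) (hc : c.MeetsPower Kw Kv P) :
    ∃ Ks B, Feasible Kw Kv P Ks B ∧
      crossMoment (c.jointLaw Kw Kv) (fun p => c.outputVec p - B *ᵥ p.2.2.ofLp)
        (fun p => c.outputVec p - B *ᵥ p.2.2.ofLp) = (1 + B) * Kw * (1 + B)ᵀ + Ks := by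
  obtain ⟨hX, htr⟩ := (meetsPower_iff hn hP).1 hc
  have hKu : (Kv + Kw).PosDef := Matrix.PosDef.posSemidef_add hKv hKw
  obtain ⟨L, d, hL⟩ := exists_isUnitLDL hKu
  have hU : CoordL2 (c.jointLaw Kw Kv) totalNoise := coordL2_totalNoise
  set T := crossMoment (c.jointLaw Kw Kv) c.inputVec fun p => L *ᵥ totalNoise p with hT
  -- Causality: for `i ≤ j` the input `Xᵢ` is a function of `M` and of the total noise before `j`,
  -- hence independent of the centred `j`-th innovation.
  have hTlow : ∀ i j, i ≤ j → T i j = 0 := by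
    intro i j hij
    have h := indepFun_adjoin_fst c.law (f := fun p : EuclideanSpace ℝ (Fin n) ×
        EuclideanSpace ℝ (Fin n) => (L *ᵥ (p.1.ofLp + p.2.ofLp)) j)
      (by simp only [Matrix.mulVec, dotProduct]; fun_prop) (by fun_prop)
      (indepFun_innovation_add hKw.posSemidef hKv hL j)
    have hψ : Measurable fun q : 𝓜 × ({k : Fin n // k < j} → ℝ) =>
        c.causalInput i q.1 fun k => q.2 ⟨k.1, k.2.trans_le hij⟩ :=
      (c.measurable_causalInput i).comp
        (f := fun q : 𝓜 × ({k : Fin n // k < j} → ℝ) =>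
          (q.1, fun k : {k : Fin n // k < i} => q.2 ⟨k.1, k.2.trans_le hij⟩)) (by fun_prop)
    have h' := h.comp measurable_id hψ
    have hind : IndepFun (fun p => (L *ᵥ totalNoise p) j) (fun p => c.inputVec p i)
        (c.jointLaw Kw Kv) := by
      convert! h' using 1
      funext p
      exact c.input_eq_causalInput _ _ _ _
    have hz : ∫ p, (L *ᵥ totalNoise p) j ∂(c.jointLaw Kw Kv) = 0 := by
      rw [← integral_noise_eq_zero (c := c) (Kw := Kw) (Kv := Kv) L L j]
      simp only [totalNoise, Matrix.mulVec_add]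
    simp only [hT, crossMoment, Matrix.of_apply]
    rw [hind.symm.integral_fun_mul_eq_mul_integral (hX i).aestronglyMeasurable
      ((hU.mulVec L) j).aestronglyMeasurable, hz, mul_zero]
  -- This is the estimator `E[X Uᵀ] (Kv + Kw)⁻¹`, since `(Kv + Kw)⁻¹ = Lᵀ D⁻¹ L`. In the innovation
  -- form it is visibly strictly lower triangular.
  set B := T * (Matrix.diagonal fun i => (d i : ℝ)⁻¹) * L with hB
  have hBlow : ∀ i j, i ≤ j → B i j = 0 := by
    intro i j hij
    rw [hB, Matrix.mul_apply]
    refine Finset.sum_eq_zero fun k _ => ?_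
    rw [Matrix.mul_diagonal]
    rcases le_or_gt i k with h | h
    · simp [hTlow i k h]
    · simp [hL.lower k j (h.trans_le hij)]
  have hXU : crossMoment (c.jointLaw Kw Kv) c.inputVec totalNoise = B * (Kv + Kw) := by
    have hLT : IsUnit (Lᵀ).det := by simp [hL.det_eq_one]
    have h1 : B * (Kv + Kw) * Lᵀ = T := by
      rw [hB, Matrix.mul_assoc, Matrix.mul_assoc, ← Matrix.mul_assoc L, hL.conj, Matrix.mul_assoc,
        Matrix.diagonal_mul_diagonal]
      have : (fun i => (d i : ℝ)⁻¹ * d i) = fun _ => 1 := by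
        funext i
        exact inv_mul_cancel₀ (by exact_mod_cast hL.ne_zero i)
      rw [this, Matrix.diagonal_one, Matrix.mul_one]
    rw [hT, crossMoment_mulVec_right hX hU] at h1
    rw [← Matrix.mul_nonsing_inv_cancel_right _ (B * (Kv + Kw)) hLT, h1,
      Matrix.mul_nonsing_inv_cancel_right _ _ hLT]
  set S : 𝓜 × EuclideanSpace ℝ (Fin n) × EuclideanSpace ℝ (Fin n) → Fin n → ℝ :=
    fun p => c.inputVec p - B *ᵥ totalNoise p with hSdef
  have hS : CoordL2 (c.jointLaw Kw Kv) S := hX.sub (hU.mulVec B)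
  have hSU : crossMoment (c.jointLaw Kw Kv) S totalNoise = 0 := by
    rw [hSdef, crossMoment_sub_left hX (hU.mulVec B) hU, crossMoment_mulVec_left hU hU, hXU,
      crossMoment_totalNoise hKw.posSemidef hKv, sub_self]
  -- Orthogonality to `U` alone does not give this. Split `W = R + G U` by linear estimation: `R` is
  -- centred and independent of `(M, U)`, which determines `S`.
  have hSW : crossMoment (c.jointLaw Kw Kv) S (fun p => p.2.1.ofLp) = 0 := by
    set G := Kw * (Kv + Kw)⁻¹ with hG
    set R : 𝓜 × EuclideanSpace ℝ (Fin n) × EuclideanSpace ℝ (Fin n) → Fin n → ℝ :=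
      fun p => p.2.1.ofLp - G *ᵥ totalNoise p with hRdef
    have hR : CoordL2 (c.jointLaw Kw Kv) R := (c.coordL2_fst_noise Kw Kv).sub (hU.mulVec G)
    have hSR : crossMoment (c.jointLaw Kw Kv) S R = 0 := by
      have h := indepFun_adjoin_fst c.law (f := fun p : EuclideanSpace ℝ (Fin n) ×
          EuclideanSpace ℝ (Fin n) => p.1.ofLp - G *ᵥ (p.1.ofLp + p.2.ofLp))
        (by fun_prop) (by fun_prop)
        (indepFun_residual_add hKw hKv)
      ext i j
      have hψ : Measurable fun q : 𝓜 × (Fin n → ℝ) =>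
          c.causalInput i q.1 (fun k => q.2 k) - (B *ᵥ q.2) i := by
        refine Measurable.sub ?_ (by simp only [Matrix.mulVec, dotProduct]; fun_prop)
        exact (c.measurable_causalInput i).comp (f := fun q : 𝓜 × (Fin n → ℝ) =>
          (q.1, fun k : {k : Fin n // k < i} => q.2 k)) (by fun_prop)
      have hφ : Measurable fun x : Fin n → ℝ => x j := measurable_pi_apply j
      have h' := h.comp hφ hψ
      have hind : IndepFun (fun p => R p j) (fun p => S p i) (c.jointLaw Kw Kv) := by
        convert! h' using 1
        funext p
        simp only [hSdef, Pi.sub_apply, Function.comp]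
        congr 1
        exact c.input_eq_causalInput _ _ _ _
      have hz : ∫ p, R p j ∂(c.jointLaw Kw Kv) = 0 := by
        rw [← integral_noise_eq_zero (c := c) (Kw := Kw) (Kv := Kv) (1 - G) (-G) j]
        congr 1
        funext p
        simp only [hRdef, totalNoise, Matrix.mulVec_add, Matrix.sub_mulVec, Matrix.neg_mulVec,
          Matrix.one_mulVec, Pi.add_apply, Pi.sub_apply, Pi.neg_apply]
        ring
      simp only [crossMoment, Matrix.of_apply, Matrix.zero_apply]
      rw [hind.symm.integral_fun_mul_eq_mul_integral (hS i).aestronglyMeasurable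
        (hR j).aestronglyMeasurable, hz, mul_zero]
    have hW : (fun p : 𝓜 × EuclideanSpace ℝ (Fin n) × EuclideanSpace ℝ (Fin n) => p.2.1.ofLp) =
        fun p => R p + G *ᵥ totalNoise p := by
      funext p
      simp [hRdef]
    rw [hW, crossMoment_add_right hS hR (hU.mulVec G), crossMoment_mulVec_right hS hU, hSR, hSU]
    simp
  obtain ⟨h1, h2⟩ := crossMoment_of_orthogonal (B := B) hKw.posSemidef hKv hS
    (fun p => by simp [hSdef]) hSW hSU
  refine ⟨_, B, ⟨posSemidef_crossMoment_self hS, hBlow, ?_⟩, h2⟩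
  rwa [← h1]

/-- Take as reference the Gaussian law with the true second moments of the corrected outputs. The
quadratic term then cancels the `1/2`, and the discarded divergence is nonnegative. -/
lemma rate_le_objective (hn : 0 < n) (hKw : Kw.PosDef) (hKv : Kv.PosSemidef)
    {P : ℝ} (hP : 0 ≤ P) (hc : c.MeetsPower Kw Kv P) :
    ∃ Ks B, Feasible Kw Kv P Ks B ∧ c.rate Kw Kv ≤ ENNReal.ofReal (objective Kw Ks B) := by
  obtain ⟨Ks, B, hf, hK⟩ := exists_feasible_of_meetsPower hn hKw hKv hP hc
  obtain ⟨Lw, s, hw⟩ := exists_isUnitLDL hKw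
  obtain ⟨L, d, hL⟩ := exists_isUnitLDL (posDef_outputCov hKw hf.1 hf.2.1)
  refine ⟨Ks, B, hf, ?_⟩
  have hstep := stepInfo_add_klDiv hKw.posSemidef hKv ((meetsPower_iff hn hP).1 hc).1 hw hL B
  have hval : ∀ i, 1 / 2 * Real.log (d i / s i) + (L * crossMoment (c.jointLaw Kw Kv)
        (fun p => c.outputVec p - B *ᵥ p.2.2.ofLp) (fun p => c.outputVec p - B *ᵥ p.2.2.ofLp) *
          Lᵀ) i i / (2 * d i) - 1 / 2 = 1 / 2 * Real.log (d i / s i) := fun i => by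
    have : (d i : ℝ) ≠ 0 := by exact_mod_cast hL.ne_zero i
    rw [hK, hL.conj, Matrix.diagonal_apply_eq]
    field_simp
    ring
  simp only [hval] at hstep
  rw [rate_eq, objective_eq_sum hw hL, ENNReal.ofReal_div_of_pos (by positivity),
    ENNReal.ofReal_div_of_pos (Real.log_pos (by norm_num)), ENNReal.ofReal_natCast,
    ENNReal.ofReal_sum_of_nonneg fun i _ => (hstep i).1]
  gcongr with i
  rw [← (hstep i).2]
  exact le_self_add

end FeedbackCode

end NoisyFeedback

namespace NoisyFeedback

variable {n : ℕ} {𝓜 : Type} [MeasurableSpace 𝓜]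

/-! ### Linear feedback schemes and achievability by Gaussian messages -/

section LinearCode

lemma strictLower_mulVec {D : Matrix (Fin n) (Fin n) ℝ} (hD : ∀ i j, i ≤ j → D i j = 0)
    (x : Fin n → ℝ) (i : Fin n) :
    (D *ᵥ x) i = ∑ j : {j : Fin n // j < i}, D i j * x j := by
  have h := unitLower_mulVec (L := 1 + D) (fun i => by simp [hD])
    (fun i j hij => by simp [Matrix.one_apply_ne hij.ne, hD i j hij.le]) x i
  rw [Matrix.add_mulVec, Matrix.one_mulVec, Pi.add_apply, add_right_inj] at h
  rw [h]
  refine Finset.sum_congr rfl fun j _ => ?_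
  rw [Matrix.add_apply, Matrix.one_apply_ne j.2.ne', zero_add]

lemma strictLower_mul_inv_one_add {B : Matrix (Fin n) (Fin n) ℝ} (hB : ∀ i j, i ≤ j → B i j = 0)
    {i j : Fin n} (hij : i ≤ j) : (B * (1 + B)⁻¹) i j = 0 := by
  have hu : IsUnit (1 + B).det := by rw [det_one_add_of_strictLower hB]; exact isUnit_one
  have : Invertible (1 + B) := Matrix.invertibleOfIsUnitDet _ hu
  have hT : Matrix.BlockTriangular (1 + B) (OrderDual.toDual : Fin n → (Fin n)ᵒᵈ) := by
    intro a b hab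
    have hab : a < b := hab
    simp [Matrix.one_apply_ne hab.ne, hB a b hab.le]
  have hinv := Matrix.blockTriangular_inv_of_blockTriangular hT
  rw [Matrix.mul_apply]
  refine Finset.sum_eq_zero fun k _ => ?_
  rcases le_or_gt i k with h | h
  · rw [hB i k h, zero_mul]
  · rw [hinv (show OrderDual.toDual j < OrderDual.toDual k from h.trans_le hij), mul_zero]

/-- The scheme that sends `s(m) + B (Wⁿ + Vⁿ)`: it recovers the total noise `Wⁿ + Vⁿ` from the
feedback and the message. -/
noncomputable def linearCode (ν : Measure 𝓜) [IsProbabilityMeasure ν] (s : 𝓜 → Fin n → ℝ)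
    (hs : Measurable s) (B : Matrix (Fin n) (Fin n) ℝ) : FeedbackCode n 𝓜 where
  law := ν
  isProb := inferInstance
  enc i m z := s m i + ∑ j : {j : Fin n // j < i}, (B * (1 + B)⁻¹) i j * (z j - s m j)
  measurable_enc i := by
    unfold Function.uncurry
    fun_prop

variable {ν : Measure 𝓜} [IsProbabilityMeasure ν] {s : 𝓜 → Fin n → ℝ} {hs : Measurable s}
  {B : Matrix (Fin n) (Fin n) ℝ}

/-- By induction the feedback minus the signal is `(1 + B) U` on the past. Applying `B (1 + B)⁻¹`
yields `B U`, and this matrix is strictly lower triangular, so the past suffices. -/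
lemma linearCode_input (hB : ∀ i j, i ≤ j → B i j = 0) (m : 𝓜)
    (w v : EuclideanSpace ℝ (Fin n)) (i : Fin n) :
    (linearCode ν s hs B).input m w v i = s m i + (B *ᵥ (w.ofLp + v.ofLp)) i := by
  have hu : IsUnit (1 + B).det := by rw [det_one_add_of_strictLower hB]; exact isUnit_one
  induction i using WellFoundedLT.induction with
  | ind i ih =>
    rw [FeedbackCode.input]
    have hz : ∀ j : {j : Fin n // j < i},
        (linearCode ν s hs B).input m w v j + w.ofLp j + v.ofLp j - s m j =
          ((1 + B) *ᵥ (w.ofLp + v.ofLp)) j.1 := fun j => by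
      rw [ih j.1 j.2, Matrix.add_mulVec, Matrix.one_mulVec]
      simp only [Pi.add_apply]
      ring
    change s m i + ∑ j : {j : Fin n // j < i}, (B * (1 + B)⁻¹) i j *
      ((linearCode ν s hs B).input m w v j + w.ofLp j + v.ofLp j - s m j) = _
    simp only [hz]
    rw [← strictLower_mulVec (D := B * (1 + B)⁻¹)
      (fun i j hij => strictLower_mul_inv_one_add hB hij), Matrix.mulVec_mulVec,
      Matrix.nonsing_inv_mul_cancel_right _ _ hu]

lemma linearCode_inputVec (hB : ∀ i j, i ≤ j → B i j = 0)
    (p : 𝓜 × EuclideanSpace ℝ (Fin n) × EuclideanSpace ℝ (Fin n)) :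
    (linearCode ν s hs B).inputVec p = s p.1 + B *ᵥ FeedbackCode.totalNoise p := by
  funext i
  exact linearCode_input hB _ _ _ i

variable {Kw Kv : Matrix (Fin n) (Fin n) ℝ}

lemma coordL2_message (hL2 : CoordL2 ν s) :
    CoordL2 ((linearCode ν s hs B).jointLaw Kw Kv) fun p => s p.1 :=
  fun i => (hL2 i).comp_fst _

lemma linearCode_coordL2_inputVec (hL2 : CoordL2 ν s) (hB : ∀ i j, i ≤ j → B i j = 0) :
    CoordL2 ((linearCode ν s hs B).jointLaw Kw Kv) (linearCode ν s hs B).inputVec := by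
  rw [funext (linearCode_inputVec (ν := ν) (s := s) (hs := hs) hB)]
  exact (coordL2_message hL2).add (FeedbackCode.coordL2_totalNoise.mulVec B)

lemma linearCode_crossMoment (hKw : Kw.PosSemidef) (hKv : Kv.PosSemidef) (hL2 : CoordL2 ν s)
    (hB : ∀ i j, i ≤ j → B i j = 0) :
    crossMoment ((linearCode ν s hs B).jointLaw Kw Kv) (linearCode ν s hs B).inputVec
        (linearCode ν s hs B).inputVec = crossMoment ν s s + B * (Kv + Kw) * Bᵀ ∧
    crossMoment ((linearCode ν s hs B).jointLaw Kw Kv)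
        (fun p => (linearCode ν s hs B).outputVec p - B *ᵥ p.2.2.ofLp)
        (fun p => (linearCode ν s hs B).outputVec p - B *ᵥ p.2.2.ofLp) =
      (1 + B) * Kw * (1 + B)ᵀ + crossMoment ν s s := by
  set c := linearCode ν s hs B with hc
  -- Independence and centred noise suffice: the signal need not have mean zero, which matters for
  -- quantized messages.
  have hz : ∀ A B' : Matrix (Fin n) (Fin n) ℝ, crossMoment (c.jointLaw Kw Kv) (fun p => s p.1)
      (fun p => A *ᵥ p.2.1.ofLp + B' *ᵥ p.2.2.ofLp) = 0 := by
    intro A B'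
    ext i j
    have h := integral_prod_mul (μ := ν) (ν := noiseLaw Kw Kv) (fun m => s m i)
      (fun q => linComb A B' q j)
    have h0 : ∫ q, linComb A B' q j ∂(noiseLaw Kw Kv) = 0 := integral_linComb A B' j
    rw [h0, mul_zero] at h
    exact h
  have hss : crossMoment (c.jointLaw Kw Kv) (fun p => s p.1) (fun p => s p.1) =
      crossMoment ν s s := by
    have hT : (c.jointLaw Kw Kv).map Prod.fst = ν := measurePreserving_fst.map_eq
    exact crossMoment_map measurable_fst hT (fun i => (measurable_pi_apply i).comp hs)
      (fun i => (measurable_pi_apply i).comp hs)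
  rw [← hss]
  refine FeedbackCode.crossMoment_of_orthogonal hKw hKv (coordL2_message hL2)
    (linearCode_inputVec hB) ?_ ?_
  · simpa using hz 1 0
  · have h := hz 1 1
    simp only [Matrix.one_mulVec] at h
    exact h

lemma linearCode_meetsPower (hn : 0 < n) (hKw : Kw.PosSemidef) (hKv : Kv.PosSemidef) {P : ℝ}
    (hP : 0 ≤ P) (hL2 : CoordL2 ν s) (hB : ∀ i j, i ≤ j → B i j = 0)
    (htr : (crossMoment ν s s + B * (Kv + Kw) * Bᵀ).trace ≤ n * P) :
    (linearCode ν s hs B).MeetsPower Kw Kv P := by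
  rw [FeedbackCode.meetsPower_iff hn hP, (linearCode_crossMoment hKw hKv hL2 hB).1]
  exact ⟨linearCode_coordL2_inputVec hL2 hB, htr⟩

/-- The law of the outputs of the linear scheme, corrected by `B Vⁿ`. -/
noncomputable def correctedLaw (ν : Measure 𝓜) (s : 𝓜 → Fin n → ℝ)
    (B Kw : Matrix (Fin n) (Fin n) ℝ) : Measure (EuclideanSpace ℝ (Fin n)) :=
  (ν.prod (multivariateGaussian 0 Kw)).map fun q => WithLp.toLp 2 (s q.1 + (1 + B) *ᵥ q.2.ofLp)

/-- The past outputs and the feedback noise in terms of the corrected outputs. -/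
def sideMap (B : Matrix (Fin n) (Fin n) ℝ) (i : Fin n)
    (q : EuclideanSpace ℝ (Fin n) × EuclideanSpace ℝ (Fin n)) :
    ({j : Fin n // j < i} → ℝ) × (Fin n → ℝ) :=
  (fun j => q.1.ofLp j + (B *ᵥ q.2.ofLp) j, q.2.ofLp)

lemma measurable_mulVec_ofLp (B : Matrix (Fin n) (Fin n) ℝ) (i : Fin n) :
    Measurable fun q : EuclideanSpace ℝ (Fin n) => (B *ᵥ q.ofLp) i := by
  simp only [Matrix.mulVec, dotProduct]
  fun_prop

lemma measurable_sideMap (B : Matrix (Fin n) (Fin n) ℝ) (i : Fin n) :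
    Measurable (sideMap B i) := by
  have := measurable_mulVec_ofLp B
  unfold sideMap
  fun_prop

lemma measurable_corrected (hs : Measurable s) (B : Matrix (Fin n) (Fin n) ℝ) :
    Measurable fun q : 𝓜 × EuclideanSpace ℝ (Fin n) =>
      WithLp.toLp 2 (s q.1 + (1 + B) *ᵥ q.2.ofLp) := by
  refine (WithLp.measurable_toLp 2 (Fin n → ℝ)).comp (measurable_pi_lambda _ fun i => ?_)
  have := measurable_mulVec_ofLp (1 + B) i
  have := (measurable_pi_apply i).comp hs
  simp only [Pi.add_apply]
  fun_prop

/-- `Y = (s(M) + (1 + B) W) + B V`, where the bracket is independent of `V`. The law of outputs and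
feedback noise is thus a fixed image of a product law. -/
lemma linearCode_sideOutputLaw (hB : ∀ i j, i ≤ j → B i j = 0) (i : Fin n) :
    (linearCode ν s hs B).sideOutputLaw Kw Kv i =
      ((correctedLaw ν s B Kw).prod (multivariateGaussian 0 Kv)).map
        fun q => (sideMap B i q, q.1.ofLp i + (B *ᵥ q.2.ofLp) i) := by
  have hmf := measurable_corrected hs B
  have hm : Measurable fun q : EuclideanSpace ℝ (Fin n) × EuclideanSpace ℝ (Fin n) =>
      (sideMap B i q, q.1.ofLp i + (B *ᵥ q.2.ofLp) i) := by
    have := measurable_mulVec_ofLp B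
    have := measurable_sideMap B i
    fun_prop
  have h1 : (correctedLaw ν s B Kw).prod (multivariateGaussian 0 Kv) =
      ((linearCode ν s hs B).jointLaw Kw Kv).map
        fun p => (WithLp.toLp 2 (s p.1 + (1 + B) *ᵥ p.2.1.ofLp), p.2.2) := by
    have h2 : (linearCode ν s hs B).jointLaw Kw Kv =
        ((ν.prod (multivariateGaussian 0 Kw)).prod (multivariateGaussian 0 Kv)).map
          MeasurableEquiv.prodAssoc := (Measure.prodAssoc_prod).symm
    rw [h2, Measure.map_map (by fun_prop) (MeasurableEquiv.measurable _), correctedLaw]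
    have h3 := Measure.map_prod_map (ν.prod (multivariateGaussian 0 Kw))
      (multivariateGaussian 0 Kv) hmf measurable_id
    rw [Measure.map_id] at h3
    exact h3
  rw [h1, Measure.map_map hm (by fun_prop), FeedbackCode.sideOutputLaw]
  congr 1
  funext p
  have hY : ∀ j, (linearCode ν s hs B).outputVec p j =
      s p.1 j + ((1 + B) *ᵥ p.2.1.ofLp) j + (B *ᵥ p.2.2.ofLp) j := fun j => by
    rw [FeedbackCode.outputVec, linearCode_inputVec hB, FeedbackCode.totalNoise,
      Matrix.mulVec_add, Matrix.add_mulVec, Matrix.one_mulVec]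
    simp only [Pi.add_apply]
    ring
  refine Prod.ext (Prod.ext ?_ rfl) (hY i)
  funext j
  exact hY j

/-- When the corrected outputs are Gaussian, the reference law of the output given the side
information is the true one. -/
lemma map_sideMap_eq_compProd {K L : Matrix (Fin n) (Fin n) ℝ} {d : Fin n → ℝ≥0}
    (hK : K.PosSemidef) (hKv : Kv.PosSemidef) (hL : IsUnitLDL K L d) (i : Fin n) :
    (noiseLaw K Kv).map (fun q => (sideMap B i q, q.1.ofLp i + (B *ᵥ q.2.ofLp) i)) =
      (noiseLaw K Kv).map (sideMap B i) ⊗ₘ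
        gaussianKernel (refMean B L i) (measurable_refMean B L i) (d i) := by
  have hN : Measurable fun q : EuclideanSpace ℝ (Fin n) × EuclideanSpace ℝ (Fin n) =>
      (L *ᵥ q.1.ofLp) i := (measurable_mulVec_ofLp L i).comp measurable_fst
  have hind : IndepFun (fun q => (L *ᵥ q.1.ofLp) i) (sideMap B i) (noiseLaw K Kv) := by
    have hψ : Measurable fun q : ({j : Fin n // j < i} → ℝ) × (Fin n → ℝ) =>
        ((fun j : {j : Fin n // j < i} => q.1 j + (B *ᵥ q.2) j, q.2) :
          ({j : Fin n // j < i} → ℝ) × (Fin n → ℝ)) := by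
      simp only [Matrix.mulVec, dotProduct]
      fun_prop
    exact (indepFun_innovation_fst hK hKv hL i).comp measurable_id hψ
  have h := map_prodMk_eq_compProd_gaussianKernel (measurable_sideMap B i) hN
    (measurable_refMean B L i) (map_innovation_fst hK hKv hL i) hind
  rw [← h]
  congr 1
  funext q
  have := sub_refMean (B := B) hL.diag_eq_one hL.lower (q.1.ofLp + B *ᵥ q.2.ofLp) q.2.ofLp i
  rw [add_sub_cancel_right] at this
  rw [← this]
  refine Prod.ext rfl ?_
  change _ = refMean B L i (fun j => q.1.ofLp j + (B *ᵥ q.2.ofLp) j, q.2.ofLp) +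
    ((q.1.ofLp + B *ᵥ q.2.ofLp) i - refMean B L i (fun j => q.1.ofLp j + (B *ᵥ q.2.ofLp) j,
      q.2.ofLp))
  simp

/-- Replacing the true law of the side information by the reference one can only increase the
divergence, by the chain rule. The resulting pair consists of images of product laws with a common
factor for `V`, so data processing leaves only the divergence of the corrected outputs. -/
lemma linearCode_klDiv_le {K L : Matrix (Fin n) (Fin n) ℝ} {d : Fin n → ℝ≥0}
    (hK : K.PosSemidef) (hKv : Kv.PosSemidef) (hL : IsUnitLDL K L d)
    (hB : ∀ i j, i ≤ j → B i j = 0) (i : Fin n) :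
    klDiv ((linearCode ν s hs B).sideOutputLaw Kw Kv i)
      (((linearCode ν s hs B).jointLaw Kw Kv).map ((linearCode ν s hs B).sideInfo i) ⊗ₘ
        gaussianKernel (refMean B L i) (measurable_refMean B L i) (d i)) ≤
      klDiv (correctedLaw ν s B Kw) (multivariateGaussian 0 K) := by
  set c := linearCode ν s hs B with hc
  have hcl : IsProbabilityMeasure (correctedLaw ν s B Kw) :=
    Measure.isProbabilityMeasure_map (measurable_corrected hs B).aemeasurable
  have hm : Measurable fun q : EuclideanSpace ℝ (Fin n) × EuclideanSpace ℝ (Fin n) =>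
      (sideMap B i q, q.1.ofLp i + (B *ᵥ q.2.ofLp) i) := by
    have := measurable_mulVec_ofLp B
    have := measurable_sideMap B i
    fun_prop
  have hmZ := c.measurable_sideInfo i
  have hmY : Measurable fun p => c.outputVec p i := (measurable_pi_apply i).comp
    c.measurable_outputVec
  have : IsProbabilityMeasure ((c.jointLaw Kw Kv).map (c.sideInfo i)) :=
    Measure.isProbabilityMeasure_map hmZ.aemeasurable
  have : IsProbabilityMeasure ((noiseLaw K Kv).map (sideMap B i)) :=
    Measure.isProbabilityMeasure_map (measurable_sideMap B i).aemeasurable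
  have h1 : c.sideOutputLaw Kw Kv i = (c.jointLaw Kw Kv).map (c.sideInfo i) ⊗ₘ
      condDistrib (fun p => c.outputVec p i) (c.sideInfo i) (c.jointLaw Kw Kv) :=
    (compProd_map_condDistrib hmY.aemeasurable).symm
  calc _ ≤ klDiv (c.sideOutputLaw Kw Kv i) ((noiseLaw K Kv).map (sideMap B i) ⊗ₘ
        gaussianKernel (refMean B L i) (measurable_refMean B L i) (d i)) := by
        rw [h1, klDiv_compProd_eq_add _ ((noiseLaw K Kv).map (sideMap B i))]
        exact le_add_self
    _ ≤ klDiv ((correctedLaw ν s B Kw).prod (multivariateGaussian 0 Kv)) (noiseLaw K Kv) := by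
        rw [← map_sideMap_eq_compProd hK hKv hL, hc, linearCode_sideOutputLaw hB]
        exact klDiv_map_le _ _ hm
    _ = _ := by
        rw [noiseLaw, ← Measure.compProd_const, ← Measure.compProd_const, klDiv_compProd_left]

/-- For a Gaussian message the corrected outputs are Gaussian. -/
lemma correctedLaw_gaussian (hKw : Kw.PosSemidef) {Ks : Matrix (Fin n) (Fin n) ℝ}
    (hKs : Ks.PosSemidef) :
    correctedLaw (multivariateGaussian 0 Ks) WithLp.ofLp B Kw =
      multivariateGaussian 0 ((1 + B) * Kw * (1 + B)ᵀ + Ks) := by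
  have h := map_linComb hKs hKw 1 (1 + B)
  rw [Matrix.one_mul, Matrix.transpose_one, Matrix.mul_one] at h
  rw [add_comm _ Ks, ← h, correctedLaw]
  simp only [linComb_apply, Matrix.one_mulVec]

/-- The Cover–Pombra scheme attains the objective. -/
lemma exists_coverPombra (hn : 0 < n) (hKw : Kw.PosDef) (hKv : Kv.PosSemidef) {P : ℝ}
    (hP : 0 ≤ P) {Ks B : Matrix (Fin n) (Fin n) ℝ} (hf : Feasible Kw Kv P Ks B) :
    ∃ c : FeedbackCode n (EuclideanSpace ℝ (Fin n)), IsCoverPombra c Ks B ∧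
      c.MeetsPower Kw Kv P ∧ c.rate Kw Kv = ENNReal.ofReal (objective Kw Ks B) := by
  obtain ⟨hKs, hB, htr⟩ := hf
  have hs : Measurable (WithLp.ofLp : EuclideanSpace ℝ (Fin n) → Fin n → ℝ) := by fun_prop
  have hL2 := coordL2_multivariateGaussian Ks
  have hss := crossMoment_multivariateGaussian hKs
  set c := linearCode (multivariateGaussian 0 Ks) WithLp.ofLp hs B with hc
  have hmeets : c.MeetsPower Kw Kv P :=
    linearCode_meetsPower hn hKw.posSemidef hKv hP hL2 hB (by rwa [hss])
  refine ⟨c, ⟨rfl, fun m w v i => linearCode_input hB m w v i⟩, hmeets, ?_⟩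
  have hK := posDef_outputCov hKw hKs hB
  obtain ⟨Lw, s, hw⟩ := exists_isUnitLDL hKw
  obtain ⟨L, d, hL⟩ := exists_isUnitLDL hK
  have hstep := FeedbackCode.stepInfo_add_klDiv hKw.posSemidef hKv
    ((FeedbackCode.meetsPower_iff hn hP).1 hmeets).1 hw hL B
  have hval : ∀ i, 1 / 2 * Real.log (d i / s i) + (L * crossMoment (c.jointLaw Kw Kv)
        (fun p => c.outputVec p - B *ᵥ p.2.2.ofLp) (fun p => c.outputVec p - B *ᵥ p.2.2.ofLp) *
          Lᵀ) i i / (2 * d i) - 1 / 2 = 1 / 2 * Real.log (d i / s i) := fun i => by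
    have : (d i : ℝ) ≠ 0 := by exact_mod_cast hL.ne_zero i
    rw [hc, (linearCode_crossMoment hKw.posSemidef hKv hL2 hB).2, hss, hL.conj,
      Matrix.diagonal_apply_eq]
    field_simp
    ring
  simp only [hval] at hstep
  rw [FeedbackCode.rate_eq, objective_eq_sum hw hL, ENNReal.ofReal_div_of_pos (by positivity),
    ENNReal.ofReal_div_of_pos (Real.log_pos (by norm_num)), ENNReal.ofReal_natCast,
    ENNReal.ofReal_sum_of_nonneg fun i _ => (hstep i).1]
  congr 3
  funext i
  rw [← (hstep i).2]
  -- For a Gaussian message the corrected outputs have exactly the reference law, so the inequality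
  -- of the converse becomes an equality.
  have h0 := linearCode_klDiv_le (hs := hs) (ν := multivariateGaussian 0 Ks) (Kw := Kw)
    hK.posSemidef hKv hL hB i
  rw [correctedLaw_gaussian hKw.posSemidef hKs, klDiv_self, nonpos_iff_eq_zero] at h0
  rw [h0, add_zero]

end LinearCode

end NoisyFeedback

namespace NoisyFeedback

variable {n : ℕ} {𝓜 : Type} [MeasurableSpace 𝓜]

/-! ### Divergence between shifted Gaussian laws -/

section Shift

/-- The law of a vector of `n` independent standard Gaussian variables. -/
noncomputable abbrev stdNormal (n : ℕ) : Measure (Fin n → ℝ) :=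
  Measure.pi fun _ => gaussianReal 0 1

/-- The one-dimensional Cameron–Martin density, by completing the square. -/
lemma gaussianReal_eq_withDensity_exp (h : ℝ) :
    gaussianReal h 1 = (gaussianReal 0 1).withDensity
      fun y => ENNReal.ofReal (Real.exp (h * y - h ^ 2 / 2)) := by
  rw [gaussianReal_of_var_ne_zero _ one_ne_zero, gaussianReal_of_var_ne_zero _ one_ne_zero,
    ← withDensity_mul _ (measurable_gaussianPDF _ _) (by fun_prop)]
  congr 1
  funext y
  rw [Pi.mul_apply, gaussianPDF, gaussianPDF, ← ENNReal.ofReal_mul (gaussianPDFReal_nonneg _ _ _),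
    gaussianPDFReal, gaussianPDFReal, mul_assoc _ (Real.exp _) (Real.exp _), ← Real.exp_add]
  congr 3
  simp only [NNReal.coe_one]
  ring

lemma pi_gaussianReal_eq_withDensity (h : Fin n → ℝ) :
    (Measure.pi fun i => gaussianReal (h i) 1) = (stdNormal n).withDensity
      fun y => ENNReal.ofReal (Real.exp (∑ i, (h i * y i - h i ^ 2 / 2))) := by
  refine Measure.pi_eq fun t ht => ?_
  have hind : iIndepFun (fun i (y : Fin n → ℝ) => (t i).indicator
      (fun x => ENNReal.ofReal (Real.exp (h i * x - h i ^ 2 / 2))) (y i)) (stdNormal n) :=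
    iIndepFun_pi (X := fun i => (t i).indicator
      (fun x => ENNReal.ofReal (Real.exp (h i * x - h i ^ 2 / 2)))) fun i =>
      ((Measurable.indicator (by fun_prop) (ht i))).aemeasurable
  have hm : ∀ i, Measurable ((t i).indicator
      (fun x => ENNReal.ofReal (Real.exp (h i * x - h i ^ 2 / 2)))) := fun i =>
    Measurable.indicator (by fun_prop) (ht i)
  rw [withDensity_apply _ (MeasurableSet.univ_pi ht),
    ← lintegral_indicator (MeasurableSet.univ_pi ht)]
  have heq : ∀ y : Fin n → ℝ, (Set.univ.pi t).indicator
      (fun y => ENNReal.ofReal (Real.exp (∑ i, (h i * y i - h i ^ 2 / 2)))) y =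
      ∏ i, (t i).indicator (fun x => ENNReal.ofReal (Real.exp (h i * x - h i ^ 2 / 2))) (y i) := by
    intro y
    by_cases hy : y ∈ Set.univ.pi t
    · rw [Set.indicator_of_mem hy, Real.exp_sum,
        ENNReal.ofReal_prod_of_nonneg fun i _ => (Real.exp_pos _).le]
      refine Finset.prod_congr rfl fun i _ => ?_
      rw [Set.indicator_of_mem (hy i (Set.mem_univ i))]
    · rw [Set.indicator_of_notMem hy]
      simp only [Set.mem_pi, Set.mem_univ, true_imp_iff, not_forall] at hy
      obtain ⟨i, hi⟩ := hy
      exact (Finset.prod_eq_zero (Finset.mem_univ i) (Set.indicator_of_notMem hi _)).symm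
  simp only [heq]
  rw [lintegral_prod_eq_prod_lintegral_of_indepFun _ _ hind
    fun i => (hm i).comp (measurable_pi_apply i)]
  refine Finset.prod_congr rfl fun i _ => ?_
  rw [gaussianReal_eq_withDensity_exp, withDensity_apply _ (ht i), ← lintegral_indicator (ht i)]
  exact (measurePreserving_eval (fun _ : Fin n => gaussianReal 0 1) i).lintegral_comp (hm i)

lemma map_add_stdNormal (h : Fin n → ℝ) :
    (stdNormal n).map (fun y => h + y) = (stdNormal n).withDensity
      fun y => ENNReal.ofReal (Real.exp (∑ i, (h i * y i - h i ^ 2 / 2))) := by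
  rw [← pi_gaussianReal_eq_withDensity]
  have hg : ∀ i, gaussianReal (h i) 1 = (gaussianReal 0 1).map fun y => h i + y := fun i => by
    rw [gaussianReal_map_const_add, zero_add]
  simp only [hg]
  exact Measure.pi_map_pi (f := fun i y => h i + y) fun i => by fun_prop

/-- The joint law of `m` and `h m + G`, with `G` standard Gaussian. -/
lemma map_shift_eq_withDensity (ν : Measure 𝓜) [IsProbabilityMeasure ν] {h : 𝓜 → Fin n → ℝ}
    (hh : Measurable h) :
    (ν.prod (stdNormal n)).map (fun q => (q.1, h q.1 + q.2)) =
      (ν.prod (stdNormal n)).withDensity fun q =>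
        ENNReal.ofReal (Real.exp (∑ i, (h q.1 i * q.2 i - h q.1 i ^ 2 / 2))) := by
  have hm : Measurable fun q : 𝓜 × (Fin n → ℝ) => (q.1, h q.1 + q.2) := by fun_prop
  have hd : Measurable fun q : 𝓜 × (Fin n → ℝ) =>
        ENNReal.ofReal (Real.exp (∑ i, (h q.1 i * q.2 i - h q.1 i ^ 2 / 2))) := by fun_prop
  ext t ht
  rw [Measure.map_apply hm ht, Measure.prod_apply (hm ht), withDensity_apply _ ht,
    ← lintegral_indicator ht, lintegral_prod _ (hd.indicator ht).aemeasurable]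
  refine lintegral_congr fun m => ?_
  have h1 := congrArg (fun ρ => ρ (Prod.mk m ⁻¹' t)) (map_add_stdNormal (h m))
  rw [Measure.map_apply (by fun_prop) (measurable_prodMk_left ht),
    withDensity_apply _ (measurable_prodMk_left ht),
    ← lintegral_indicator (measurable_prodMk_left ht)] at h1
  exact h1

/-- Keeping the message in the joint law makes both densities explicit Cameron–Martin exponentials.
With `Δ = h - h'`, the log-likelihood ratio at the shifted point is `|Δ|² / 2 + Δ · G`, and the
second term has mean zero. -/
lemma klDiv_map_shift_eq (ν : Measure 𝓜) [IsProbabilityMeasure ν] {h h' : 𝓜 → Fin n → ℝ}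
    (hh : Measurable h) (hh' : Measurable h') (hL2 : CoordL2 ν h) (hL2' : CoordL2 ν h') :
    klDiv ((ν.prod (stdNormal n)).map fun q => (q.1, h q.1 + q.2))
        ((ν.prod (stdNormal n)).map fun q => (q.1, h' q.1 + q.2)) =
      ENNReal.ofReal ((crossMoment ν (fun m => h m - h' m) fun m => h m - h' m).trace / 2) := by
  have hm : Measurable fun q : 𝓜 × (Fin n → ℝ) => (q.1, h q.1 + q.2) := by fun_prop
  have hm' : Measurable fun q : 𝓜 × (Fin n → ℝ) => (q.1, h' q.1 + q.2) := by fun_prop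
  have : IsProbabilityMeasure ((ν.prod (stdNormal n)).map fun q => (q.1, h' q.1 + q.2)) :=
    Measure.isProbabilityMeasure_map hm'.aemeasurable
  have hlog : ∀ q : 𝓜 × (Fin n → ℝ),
      Real.log (Real.exp (∑ i, (h q.1 i * (h q.1 + q.2) i - h q.1 i ^ 2 / 2)) /
        Real.exp (∑ i, (h' q.1 i * (h q.1 + q.2) i - h' q.1 i ^ 2 / 2))) =
      ∑ i, ((h q.1 - h' q.1) i * (h q.1 - h' q.1) i / 2 + (h q.1 - h' q.1) i * q.2 i) := by
    intro q
    rw [← Real.exp_sub, Real.log_exp, ← Finset.sum_sub_distrib]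
    refine Finset.sum_congr rfl fun i _ => ?_
    simp only [Pi.add_apply, Pi.sub_apply]
    ring
  have hΔ := hL2.sub hL2'
  have hi1 : ∀ i, Integrable (fun q : 𝓜 × (Fin n → ℝ) =>
      (h q.1 - h' q.1) i * (h q.1 - h' q.1) i / 2) (ν.prod (stdNormal n)) := fun i =>
    ((hΔ.integrable_mul hΔ i i).comp_fst (stdNormal n)).div_const 2
  have hg : ∀ i, MemLp (fun y : Fin n → ℝ => y i) 2 (stdNormal n) := fun i =>
    (memLp_id_gaussianReal' (μ := 0) (v := 1) 2 (by simp)).comp_measurePreserving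
      (measurePreserving_eval (fun _ : Fin n => gaussianReal 0 1) i)
  have hi2 : ∀ i, Integrable (fun q : 𝓜 × (Fin n → ℝ) =>
      (h q.1 - h' q.1) i * q.2 i) (ν.prod (stdNormal n)) := fun i =>
    ((hΔ i).integrable (by simp)).mul_prod ((hg i).integrable (by simp))
  have hi3 : ∀ i, Integrable (fun q : 𝓜 × (Fin n → ℝ) =>
      (h q.1 - h' q.1) i * (h q.1 - h' q.1) i / 2 +
      (h q.1 - h' q.1) i * q.2 i) (ν.prod (stdNormal n)) := fun i => (hi1 i).add (hi2 i)
  have hg0 : ∀ i, ∫ y, y i ∂(stdNormal n) = 0 := fun i => by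
    have := integral_eval (μ := fun _ : Fin n => gaussianReal 0 1) (i := i)
    rw [this, integral_id_gaussianReal]
  have hval : ∫ q : 𝓜 × (Fin n → ℝ), ∑ i, ((h q.1 - h' q.1) i * (h q.1 - h' q.1) i / 2 +
      (h q.1 - h' q.1) i * q.2 i) ∂(ν.prod (stdNormal n)) =
      (crossMoment ν (fun m => h m - h' m) fun m => h m - h' m).trace / 2 := by
    rw [integral_finsetSum _ fun i _ => hi3 i, Matrix.trace, Finset.sum_div]
    refine Finset.sum_congr rfl fun i _ => ?_
    rw [integral_add (hi1 i) (hi2 i), integral_div,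
      integral_prod_mul (fun m => (h m - h' m) i) (fun y : Fin n → ℝ => y i), hg0, mul_zero,
      add_zero, integral_fun_fst (fun m => (h m - h' m) i * (h m - h' m) i)]
    simp [crossMoment]
  have key := klDiv_withDensity_eq_ofReal_integral_log (μ := ν.prod (stdNormal n))
    (ρ := ν.prod (stdNormal n))
    (p := fun q => Real.exp (∑ i, (h q.1 i * q.2 i - h q.1 i ^ 2 / 2)))
    (q := fun q => Real.exp (∑ i, (h' q.1 i * q.2 i - h' q.1 i ^ 2 / 2)))
    (by fun_prop) (by fun_prop) (fun _ => Real.exp_pos _) (fun _ => Real.exp_pos _)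
    (T := fun q => (q.1, h q.1 + q.2)) hm
    (map_shift_eq_withDensity ν hh) (map_shift_eq_withDensity ν hh')
    (by
      simp only [hlog]
      exact integrable_finsetSum _ fun i _ => hi3 i)
  simp only [hlog, hval] at key
  exact key.2

/-- The matrix is the square root of `Kw`, invertible because its determinant squares to `det Kw >
0`. -/
lemma exists_isUnit_det_map_stdNormal {Kw : Matrix (Fin n) (Fin n) ℝ} (hKw : Kw.PosDef) :
    ∃ R : Matrix (Fin n) (Fin n) ℝ, IsUnit R.det ∧
      multivariateGaussian 0 Kw = (stdNormal n).map fun x => WithLp.toLp 2 (R *ᵥ x) := by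
  open scoped MatrixOrder in
  refine ⟨CFC.sqrt Kw, ?_, ?_⟩
  · have h := CFC.sqrt_mul_sqrt_self Kw hKw.posSemidef.nonneg
    have h2 := congrArg Matrix.det h
    rw [Matrix.det_mul] at h2
    refine isUnit_of_mul_isUnit_left (y := (CFC.sqrt Kw).det) ?_
    rw [h2]
    exact hKw.det_pos.ne'.isUnit
  · rw [multivariateGaussian, ← map_pi_eq_stdGaussian, Measure.map_map (by fun_prop) (by fun_prop)]
    congr 1
    funext x
    simp [Matrix.toEuclideanCLM_toLp]

/-- Coupled messages give corrected outputs whose laws have small divergence. -/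
lemma exists_klDiv_correctedLaw_le {Kw B : Matrix (Fin n) (Fin n) ℝ} (hKw : Kw.PosDef)
    (hB : ∀ i j, i ≤ j → B i j = 0) :
    ∃ H : Matrix (Fin n) (Fin n) ℝ, ∀ (ν : Measure 𝓜) [IsProbabilityMeasure ν]
      (s s' : 𝓜 → Fin n → ℝ), Measurable s → Measurable s' → CoordL2 ν s → CoordL2 ν s' →
      klDiv (correctedLaw ν s B Kw) (correctedLaw ν s' B Kw) ≤ ENNReal.ofReal
        ((H * crossMoment ν (fun m => s m - s' m) (fun m => s m - s' m) * Hᵀ).trace / 2) := by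
  obtain ⟨R, hR, hRlaw⟩ := exists_isUnit_det_map_stdNormal hKw
  -- With `W = R G` the corrected output is `s + A G = A (A⁻¹ s + G)`, a fixed image of a shifted
  -- standard Gaussian vector. Hence `A⁻¹` is the witness for `H`.
  set A := (1 + B) * R with hA
  have hAu : IsUnit A.det := by
    rw [hA, Matrix.det_mul, det_one_add_of_strictLower hB, one_mul]
    exact hR
  have hmA : ∀ M : Matrix (Fin n) (Fin n) ℝ, Measurable fun x : Fin n → ℝ => M *ᵥ x := fun M => by
    unfold Matrix.mulVec dotProduct
    fun_prop
  refine ⟨A⁻¹, fun ν _ s s' hs hs' hL2 hL2' => ?_⟩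
  have hlaw : ∀ t : 𝓜 → Fin n → ℝ, Measurable t → correctedLaw ν t B Kw =
      ((ν.prod (stdNormal n)).map fun q => (q.1, A⁻¹ *ᵥ t q.1 + q.2)).map
        fun q => WithLp.toLp 2 (A *ᵥ q.2) := by
    intro t ht
    have hmt : Measurable fun q : 𝓜 × (Fin n → ℝ) => (q.1, A⁻¹ *ᵥ t q.1 + q.2) :=
      measurable_fst.prodMk ((((hmA A⁻¹).comp ht).comp measurable_fst).add measurable_snd)
    have hmT : Measurable fun q : 𝓜 × (Fin n → ℝ) => WithLp.toLp 2 (A *ᵥ q.2) :=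
      (WithLp.measurable_toLp 2 _).comp ((hmA A).comp measurable_snd)
    have hmR : Measurable fun x : Fin n → ℝ => WithLp.toLp 2 (R *ᵥ x) :=
      (WithLp.measurable_toLp 2 _).comp (hmA R)
    have hprod := Measure.map_prod_map ν (stdNormal n) measurable_id hmR
    rw [Measure.map_id] at hprod
    rw [correctedLaw, hRlaw, hprod, Measure.map_map (measurable_corrected ht B)
      (measurable_id.prodMap hmR), Measure.map_map hmT hmt]
    congr 1
    funext q
    simp only [Function.comp, Prod.map, id]
    rw [Matrix.mulVec_add, Matrix.mulVec_mulVec, Matrix.mulVec_mulVec, Matrix.mul_nonsing_inv _ hAu,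
      Matrix.one_mulVec]
  have hmT : Measurable fun q : 𝓜 × (Fin n → ℝ) => WithLp.toLp 2 (A *ᵥ q.2) :=
    (WithLp.measurable_toLp 2 _).comp ((hmA A).comp measurable_snd)
  have hp : ∀ t : 𝓜 → Fin n → ℝ, Measurable t → IsProbabilityMeasure
      ((ν.prod (stdNormal n)).map fun q => (q.1, A⁻¹ *ᵥ t q.1 + q.2)) := fun t ht =>
    Measure.isProbabilityMeasure_map (measurable_fst.prodMk
      ((((hmA A⁻¹).comp ht).comp measurable_fst).add measurable_snd)).aemeasurable
  have := hp s hs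
  have := hp s' hs'
  rw [hlaw s hs, hlaw s' hs']
  -- Forgetting the message cannot increase the divergence.
  refine (klDiv_map_le _ _ hmT).trans ?_
  rw [klDiv_map_shift_eq ν (h := fun m => A⁻¹ *ᵥ s m) (h' := fun m => A⁻¹ *ᵥ s' m)
    ((hmA _).comp hs) ((hmA _).comp hs') (hL2.mulVec _) (hL2'.mulVec _)]
  have hΔ := hL2.sub hL2'
  simp only [← Matrix.mulVec_sub]
  rw [crossMoment_mulVec_left hΔ (hΔ.mulVec _), crossMoment_mulVec_right hΔ hΔ, Matrix.mul_assoc]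

end Shift

end NoisyFeedback

namespace NoisyFeedback

open Filter Topology unitInterval

variable {n : ℕ}

/-! ### Approximation by uniform finite messages -/

section Quantization

lemma trace_crossMoment_ofLp {Ω : Type*} [MeasurableSpace Ω] {μ : Measure Ω}
    {G : Ω → EuclideanSpace ℝ (Fin n)} (hG : MemLp G 2 μ) :
    (crossMoment μ (fun ω => (G ω).ofLp) fun ω => (G ω).ofLp).trace =
      (eLpNorm G 2 μ).toReal ^ 2 := by
  have h2 : ∀ i, Integrable (fun ω => G ω i * G ω i) μ := fun i => by
    have : MemLp (fun ω => G ω i) 2 μ := (EuclideanSpace.proj (𝕜 := ℝ) i).comp_memLp' hG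
    exact this.integrable_mul this
  have h1 : (crossMoment μ (fun ω => (G ω).ofLp) fun ω => (G ω).ofLp).trace =
      ∫ ω, ‖G ω‖ ^ 2 ∂μ := by
    simp only [EuclideanSpace.real_norm_sq_eq]
    simp only [sq]
    rw [integral_finsetSum _ fun i _ => h2 i]
    rfl
  rw [h1, hG.eLpNorm_eq_integral_rpow_norm (by norm_num) (by norm_num),
    ENNReal.toReal_ofReal (by positivity)]
  simp only [ENNReal.toReal_ofNat, Real.rpow_ofNat]
  rw [← Real.rpow_natCast, ← Real.rpow_mul (by positivity)]
  norm_num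

/-- Cross moments are inner products in `L²`, hence continuous. -/
lemma tendsto_crossMoment {Ω ι : Type*} [MeasurableSpace Ω] {μ : Measure Ω} {F : ℕ → Ω → ι → ℝ}
    {F₀ : Ω → ι → ℝ} (hF : ∀ k, CoordL2 μ (F k)) (hF₀ : CoordL2 μ F₀)
    (h : ∀ i, Tendsto (fun k => eLpNorm (fun ω => F k ω i - F₀ ω i) 2 μ) atTop (𝓝 0)) :
    Tendsto (fun k => crossMoment μ (F k) (F k)) atTop (𝓝 (crossMoment μ F₀ F₀)) := by
  have hL : ∀ i, Tendsto (fun k => (hF k i).toLp) atTop (𝓝 (hF₀ i).toLp) := fun i =>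
    (Lp.tendsto_Lp_iff_tendsto_eLpNorm'' _ (fun k => hF k i) _ (hF₀ i)).2 (h i)
  have hin : ∀ {f g : Ω → ℝ} (hf : MemLp f 2 μ) (hg : MemLp g 2 μ),
      inner ℝ hf.toLp hg.toLp = ∫ ω, f ω * g ω ∂μ := by
    intro f g hf hg
    rw [L2.inner_def]
    refine integral_congr_ae ?_
    filter_upwards [hf.coeFn_toLp, hg.coeFn_toLp] with ω h1 h2
    rw [h1, h2]
    exact mul_comm _ _
  refine tendsto_pi_nhds.2 fun i => tendsto_pi_nhds.2 fun j => ?_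
  have := (hL i).inner (𝕜 := ℝ) (hL j)
  simp only [hin] at this
  exact this

/-- The index of the cell of `t` in the partition of the unit interval into `N + 1` equal cells. -/
noncomputable def gridIndex (N : ℕ) (t : I) : Fin (N + 1) :=
  ⟨min ⌊(N + 1 : ℝ) * t⌋₊ N, Nat.lt_succ_of_le (min_le_right _ _)⟩

/-- The left end of a cell. -/
noncomputable def gridPoint (N : ℕ) (j : Fin (N + 1)) : I :=
  ⟨j / (N + 1), by positivity, by
    rw [div_le_one (by positivity)]
    exact_mod_cast j.2.le⟩

lemma measurable_gridIndex (N : ℕ) : Measurable (gridIndex N) := by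
  have h : Measurable fun t : I => min ⌊(N + 1 : ℝ) * t⌋₊ N :=
    (Nat.measurable_floor.comp (measurable_subtype_coe.const_mul _)).min measurable_const
  refine measurable_to_countable' fun j => ?_
  convert! h (measurableSet_singleton j.1) using 1
  ext t
  exact Fin.ext_iff

lemma abs_sub_gridPoint_le (N : ℕ) (t : I) :
    |(t : ℝ) - gridPoint N (gridIndex N t)| ≤ 1 / (N + 1) := by
  have hN : (0 : ℝ) < N + 1 := by positivity
  have h1 : ((min ⌊(N + 1 : ℝ) * t⌋₊ N : ℕ) : ℝ) ≤ (N + 1) * t :=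
    (Nat.cast_le.2 (min_le_left _ _)).trans (Nat.floor_le (mul_nonneg hN.le t.2.1))
  have h2 : (N + 1 : ℝ) * t ≤ ((min ⌊(N + 1 : ℝ) * t⌋₊ N : ℕ) : ℝ) + 1 := by
    rcases min_choice ⌊(N + 1 : ℝ) * t⌋₊ N with h | h <;> rw [h]
    · exact (Nat.lt_floor_add_one _).le
    · exact mul_le_of_le_one_right hN.le t.2.2
  have h3 : (t : ℝ) - gridPoint N (gridIndex N t) =
      ((N + 1) * t - ((min ⌊(N + 1 : ℝ) * t⌋₊ N : ℕ) : ℝ)) / (N + 1) := by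
    simp only [gridPoint, gridIndex]
    field_simp
  rw [h3, abs_of_nonneg (div_nonneg (by linarith) hN.le)]
  gcongr
  linarith

/-- Equal cells make the quantized message exactly uniform. -/
lemma map_gridIndex (N : ℕ) :
    (volume : Measure I).map (gridIndex N) = uniformOn Set.univ := by
  have hN : (0 : ℝ) < N + 1 := by positivity
  refine Measure.ext_of_singleton fun j => ?_
  rw [Measure.map_apply (measurable_gridIndex N) (measurableSet_singleton j), uniformOn_univ,
    Measure.count_singleton, Fintype.card_fin]
  have hr : (j + 1 : ℝ) / (N + 1) ∈ I := ⟨by positivity, by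
    rw [div_le_one hN]
    have := j.2
    exact_mod_cast this⟩
  have h1 : (gridIndex N ⁻¹' {j} : Set I) =ᵐ[volume] Set.Ico (gridPoint N j) ⟨_, hr⟩ := by
    -- The cap in the index puts the endpoint `1` in the last cell, outside the half-open interval;
    -- it is a null point.
    have h0 : ∀ᵐ t : I, t ≠ 1 := by
      rw [ae_iff]
      simp
    filter_upwards [h0] with t ht
    have ht1 : (t : ℝ) < 1 := lt_of_le_of_ne t.2.2 fun h => ht (Subtype.ext h)
    have hfl : ⌊(N + 1 : ℝ) * t⌋₊ ≤ N := by
      refine Nat.lt_succ_iff.1 ((Nat.floor_lt (mul_nonneg hN.le t.2.1)).2 ?_)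
      push_cast
      exact mul_lt_of_lt_one_right hN ht1
    refine propext ?_
    change gridIndex N t = j ↔ gridPoint N j ≤ t ∧ t < ⟨_, hr⟩
    have hval : (gridIndex N t : ℕ) = ⌊(N + 1 : ℝ) * t⌋₊ := min_eq_left hfl
    rw [Fin.ext_iff, hval, Nat.floor_eq_iff (mul_nonneg hN.le t.2.1),
      ← Subtype.coe_le_coe, ← Subtype.coe_lt_coe, gridPoint, div_le_iff₀' hN, lt_div_iff₀' hN]
  rw [measure_congr h1, unitInterval.volume_Ico]
  have h2 : (j + 1 : ℝ) / (N + 1) - gridPoint N j = 1 / (N + 1) := by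
    simp only [gridPoint]
    field_simp
    ring
  rw [h2, ENNReal.ofReal_div_of_pos hN, ENNReal.ofReal_one]
  norm_cast

/-- Approximate by a continuous function, sample it on the grid using uniform continuity, and shrink
the result slightly so that its norm does not exceed that of `F`: the power constraint leaves no
slack. -/
lemma exists_quantization {E : Type*} [NormedAddCommGroup E] [NormedSpace ℝ E] {F : I → E}
    (hF : MemLp F 2 volume) {ε : ℝ} (hε : 0 < ε) :
    ∃ (N : ℕ) (e : Fin (N + 1) → E),
      eLpNorm (fun t => e (gridIndex N t)) 2 volume ≤ eLpNorm F 2 volume ∧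
      eLpNorm (fun t => e (gridIndex N t) - F t) 2 volume ≤ ENNReal.ofReal ε := by
  -- The continuous approximation and the sampling cost `η` each; the shrinking costs another `2 *
  -- η`.
  set η := ε / 4 with hη
  have hη0 : 0 < η := by positivity
  obtain ⟨g, hg, hgm⟩ := hF.exists_boundedContinuous_eLpNorm_sub_le (by norm_num)
    (ENNReal.ofReal_pos.2 hη0).ne'
  obtain ⟨δ, hδ, hgδ⟩ := Metric.uniformContinuous_iff.1
    (CompactSpace.uniformContinuous_of_continuous g.continuous) η hη0
  obtain ⟨N, hN⟩ := exists_nat_one_div_lt hδ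
  set G : I → E := fun t => g (gridPoint N (gridIndex N t)) with hG
  have hGs : StronglyMeasurable G :=
    (StronglyMeasurable.of_discrete (f := fun j => g (gridPoint N j))).comp_measurable
      (measurable_gridIndex N)
  have hGm : MemLp G 2 volume := MemLp.of_bound hGs.aestronglyMeasurable ‖g‖
    (ae_of_all _ fun t => g.norm_coe_le_norm _)
  have h1 : eLpNorm (fun t => G t - g t) 2 volume ≤ ENNReal.ofReal η := by
    refine (eLpNorm_le_of_ae_bound (C := η) (ae_of_all _ fun t => ?_)).trans ?_
    · rw [← dist_eq_norm, dist_comm]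
      refine (hgδ ?_).le
      rw [Subtype.dist_eq, Real.dist_eq]
      exact (abs_sub_gridPoint_le N t).trans_lt hN
    · simp
  have h2 : eLpNorm (G - F) 2 volume ≤ ENNReal.ofReal (2 * η) := by
    have : G - F = (fun t => G t - g t) + -(F - (g : I → E)) := by
      funext t; simp
    rw [this, two_mul, ENNReal.ofReal_add hη0.le hη0.le]
    refine (eLpNorm_add_le (hGm.sub hgm).aestronglyMeasurable
      (hF.sub hgm).neg.aestronglyMeasurable (by norm_num)).trans (add_le_add h1 ?_)
    rw [eLpNorm_neg]
    exact hg
  set a := (eLpNorm F 2 volume).toReal with ha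
  have ha' : eLpNorm F 2 volume = ENNReal.ofReal a := (ENNReal.ofReal_toReal hF.eLpNorm_ne_top).symm
  have ha0 : 0 ≤ a := ENNReal.toReal_nonneg
  have hpos : 0 < a + 2 * η := by positivity
  have h3 : eLpNorm G 2 volume ≤ ENNReal.ofReal (a + 2 * η) := by
    have : G = F + (G - F) := by simp
    rw [this, ENNReal.ofReal_add ha0 (by positivity), ← ha']
    exact (eLpNorm_add_le hF.aestronglyMeasurable (hGm.sub hF).aestronglyMeasurable
      (by norm_num)).trans (add_le_add le_rfl h2)
  -- The sampled function has norm at most `a + 2 * η`, so this factor brings it down to `a`; the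
  -- removed part has norm at most `(1 - c) (a + 2 * η) = 2 * η`.
  set c := a / (a + 2 * η) with hc
  have hc0 : 0 ≤ c := by positivity
  refine ⟨N, fun j => c • g (gridPoint N j), ?_, ?_⟩
  · have : (fun t => c • g (gridPoint N (gridIndex N t))) = c • G := rfl
    rw [this, eLpNorm_const_smul, ha', Real.enorm_of_nonneg hc0]
    refine (mul_le_mul_right h3 _).trans ?_
    rw [← ENNReal.ofReal_mul hc0, hc, div_mul_cancel₀ _ hpos.ne']
  · have : (fun t => c • g (gridPoint N (gridIndex N t)) - F t) = (c - 1) • G + (G - F) := by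
      funext t
      simp [hG, sub_smul]
    have hc1 : 1 - c = 2 * η / (a + 2 * η) := by rw [hc]; field_simp; ring
    rw [this]
    refine (eLpNorm_add_le (hGm.const_smul _).aestronglyMeasurable
      (hGm.sub hF).aestronglyMeasurable (by norm_num)).trans ?_
    have h4 : ENNReal.ofReal ε = ENNReal.ofReal (2 * η) + ENNReal.ofReal (2 * η) := by
      rw [← ENNReal.ofReal_add (by positivity) (by positivity)]
      congr 1
      rw [hη]; ring
    rw [h4]
    refine add_le_add ?_ h2
    rw [eLpNorm_const_smul, ← enorm_neg, neg_sub, hc1, Real.enorm_of_nonneg (by positivity)]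
    refine (mul_le_mul_right h3 _).trans ?_
    rw [← ENNReal.ofReal_mul (by positivity), div_mul_cancel₀ _ hpos.ne']

/-- Square integrable random vectors are limits of quantized ones with no larger power. -/
lemma exists_quantization_seq {φ : I → EuclideanSpace ℝ (Fin n)} (hφ : MemLp φ 2 volume) :
    ∃ (N : ℕ → ℕ) (e : ∀ k, Fin (N k + 1) → Fin n → ℝ),
      (∀ k, CoordL2 volume fun t => e k (gridIndex (N k) t)) ∧
      (∀ k, (crossMoment volume (fun t => e k (gridIndex (N k) t))
          fun t => e k (gridIndex (N k) t)).trace ≤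
        (crossMoment volume (fun t => (φ t).ofLp) fun t => (φ t).ofLp).trace) ∧
      ∀ i, Tendsto (fun k => eLpNorm (fun t => e k (gridIndex (N k) t) i - (φ t).ofLp i) 2 volume)
        atTop (𝓝 0) := by
  choose N e he1 he2 using fun k : ℕ =>
    exists_quantization hφ (ε := 1 / ((k : ℝ) + 1)) (by positivity)
  have hm : ∀ k, MemLp (fun t => e k (gridIndex (N k) t)) 2 (volume : Measure I) := fun k =>
    ⟨((StronglyMeasurable.of_discrete (f := e k)).comp_measurable
      (measurable_gridIndex (N k))).aestronglyMeasurable, (he1 k).trans_lt hφ.2⟩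
  refine ⟨N, fun k j => (e k j).ofLp, fun k i => ?_, fun k => ?_, fun i => ?_⟩
  · exact (EuclideanSpace.proj (𝕜 := ℝ) i).comp_memLp' (hm k)
  · rw [trace_crossMoment_ofLp (hm k), trace_crossMoment_ofLp hφ]
    have := ENNReal.toReal_mono hφ.eLpNorm_ne_top (he1 k)
    gcongr
  · have h0 : Tendsto (fun k : ℕ => ENNReal.ofReal (1 / ((k : ℝ) + 1))) atTop (𝓝 0) := by
      rw [← ENNReal.ofReal_zero]
      exact ENNReal.tendsto_ofReal tendsto_one_div_add_atTop_nhds_zero_nat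
    refine tendsto_of_tendsto_of_tendsto_of_le_of_le tendsto_const_nhds h0 (fun _ => zero_le)
      fun k => le_trans ?_ (he2 k)
    refine eLpNorm_mono fun t => ?_
    rw [← PiLp.sub_apply]
    exact PiLp.norm_apply_le _ i

end Quantization

end NoisyFeedback

/-! ### Rates of finite-message schemes and the conclusion -/

namespace NoisyFeedback

open Filter Topology unitInterval

variable {n : ℕ} {𝓜 : Type} [MeasurableSpace 𝓜] {Kw Kv : Matrix (Fin n) (Fin n) ℝ}

/-- This puts the Gaussian signal and its quantizations on the same unit interval, the coupling that
the divergence bound requires. -/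
lemma correctedLaw_map {𝓜' : Type} [MeasurableSpace 𝓜'] {ν : Measure 𝓜'} [IsProbabilityMeasure ν]
    {T : 𝓜' → 𝓜} (hT : Measurable T) {s : 𝓜 → Fin n → ℝ} (hs : Measurable s)
    (B : Matrix (Fin n) (Fin n) ℝ) :
    correctedLaw (ν.map T) s B Kw = correctedLaw ν (fun m => s (T m)) B Kw := by
  have : IsProbabilityMeasure (ν.map T) := Measure.isProbabilityMeasure_map hT.aemeasurable
  have h := Measure.map_prod_map ν (multivariateGaussian 0 Kw) hT measurable_id
  rw [Measure.map_id] at h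
  rw [correctedLaw, h, Measure.map_map (measurable_corrected hs B) (hT.prodMap measurable_id)]
  rfl

/-- Compare the rate of a linear scheme with the value that it would have if the corrected outputs
were Gaussian. -/
lemma le_rate_linearCode (hKw : Kw.PosSemidef) (hKv : Kv.PosSemidef)
    {Lw : Matrix (Fin n) (Fin n) ℝ} {dw : Fin n → ℝ≥0} (hw : IsUnitLDL Kw Lw dw)
    {K L : Matrix (Fin n) (Fin n) ℝ} {d : Fin n → ℝ≥0} (hK : K.PosSemidef) (hL : IsUnitLDL K L d)
    {B : Matrix (Fin n) (Fin n) ℝ} (hB : ∀ i j, i ≤ j → B i j = 0)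
    {ν : Measure 𝓜} [IsProbabilityMeasure ν] {s : 𝓜 → Fin n → ℝ} (hs : Measurable s)
    (hL2 : CoordL2 ν s) (hn : 0 < n) {t : ℝ} (ht : 0 ≤ t)
    (hD : klDiv (correctedLaw ν s B Kw) (multivariateGaussian 0 K) ≤ ENNReal.ofReal t) :
    ENNReal.ofReal ((∑ i, (1 / 2 * Real.log (d i / dw i) +
      (L * ((1 + B) * Kw * (1 + B)ᵀ + crossMoment ν s s) * Lᵀ : Matrix (Fin n) (Fin n) ℝ) i i / (2 * d i) -
        1 / 2 - t)) / Real.log 2 / n) ≤ (linearCode ν s hs B).rate Kw Kv := by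
  have hstep := FeedbackCode.stepInfo_add_klDiv hKw hKv
    (linearCode_coordL2_inputVec (hs := hs) (Kw := Kw) (Kv := Kv) hL2 hB) hw hL B
  rw [(linearCode_crossMoment hKw hKv hL2 hB).2] at hstep
  rw [FeedbackCode.rate_eq, ENNReal.ofReal_div_of_pos (by positivity),
    ENNReal.ofReal_div_of_pos (Real.log_pos (by norm_num)), ENNReal.ofReal_natCast]
  gcongr
  -- Single summands may be negative, where `ENNReal.ofReal` truncates them to zero; subadditivity
  -- gives the inequality in the direction needed.
  refine (Finset.le_sum_of_subadditive ENNReal.ofReal ENNReal.ofReal_zero.le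
    (fun _ _ => ENNReal.ofReal_add_le) _ _).trans (Finset.sum_le_sum fun i _ => ?_)
  rw [ENNReal.ofReal_sub _ ht, tsub_le_iff_right, ← (hstep i).2]
  gcongr
  exact (linearCode_klDiv_le hK hKv hL hB i).trans hD

/-- The schemes with a uniform finite message come arbitrarily close to the objective. -/
lemma ofReal_objective_le_of_mem_upperBounds (hn : 0 < n) (hKw : Kw.PosDef) (hKv : Kv.PosSemidef)
    {P : ℝ} (hP : 0 ≤ P) {Ks B : Matrix (Fin n) (Fin n) ℝ} (hf : Feasible Kw Kv P Ks B) {b : ℝ≥0∞}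
    (hb : b ∈ upperBounds (finiteMessageRates Kw Kv P)) :
    ENNReal.ofReal (objective Kw Ks B) ≤ b := by
  obtain ⟨hKs, hB, htr⟩ := hf
  have hK := posDef_outputCov hKw hKs hB
  obtain ⟨Lw, dw, hw⟩ := exists_isUnitLDL hKw
  obtain ⟨L, d, hL⟩ := exists_isUnitLDL hK
  -- A standard Borel law is the image of the uniform law on the unit interval.
  obtain ⟨φ, hφ, hφlaw⟩ := (multivariateGaussian 0 Ks).exists_measurable_map_eq
  have hφ2 : MemLp φ 2 (volume : Measure I) := by
    have := (IsGaussian.memLp_two_id (μ := multivariateGaussian (0 : EuclideanSpace ℝ (Fin n)) Ks))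
    rw [← hφlaw] at this
    exact this.comp_of_map hφ.aemeasurable
  have hφL2 : CoordL2 (volume : Measure I) fun t => (φ t).ofLp := fun i =>
    (EuclideanSpace.proj (𝕜 := ℝ) i).comp_memLp' hφ2
  have hφc : crossMoment (volume : Measure I) (fun t => (φ t).ofLp) (fun t => (φ t).ofLp) = Ks := by
    rw [← crossMoment_multivariateGaussian hKs]
    exact (crossMoment_map (F := WithLp.ofLp) (G := WithLp.ofLp) hφ hφlaw (by fun_prop)
      (by fun_prop))
  obtain ⟨N, e, heL2, hetr, hlim⟩ := exists_quantization_seq hφ2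
  obtain ⟨H, hH⟩ := exists_klDiv_correctedLaw_le (𝓜 := I) hKw hB
  have hme : ∀ k, Measurable (e k) := fun k => measurable_of_countable _
  have hmg : ∀ k, Measurable fun t => e k (gridIndex (N k) t) := fun k =>
    (hme k).comp (measurable_gridIndex _)
  set S : ℕ → Matrix (Fin n) (Fin n) ℝ := fun k => crossMoment (volume : Measure I)
    (fun t => e k (gridIndex (N k) t)) fun t => e k (gridIndex (N k) t) with hS
  set D : ℕ → Matrix (Fin n) (Fin n) ℝ := fun k => crossMoment (volume : Measure I)
    (fun t => e k (gridIndex (N k) t) - (φ t).ofLp) fun t => e k (gridIndex (N k) t) - (φ t).ofLp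
    with hD
  have hSlim : Tendsto S atTop (𝓝 Ks) := by
    rw [← hφc]
    exact tendsto_crossMoment heL2 hφL2 hlim
  have hDlim : Tendsto D atTop (𝓝 0) := by
    have h0 : CoordL2 (volume : Measure I) fun _ => (0 : Fin n → ℝ) := fun i => MemLp.zero
    have := tendsto_crossMoment (fun k => (heL2 k).sub hφL2) h0
      (fun i => by simpa only [Pi.sub_apply, Pi.zero_apply, sub_zero] using hlim i)
    convert! this using 2
    ext i j
    simp [crossMoment]
  -- The lower bound on the rate as a function of the signal moments `S` and of the quantization
  -- error moments `D`; it is continuous and equals the objective at `(Ks, 0)`.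
  set v : Matrix (Fin n) (Fin n) ℝ → Matrix (Fin n) (Fin n) ℝ → ℝ := fun S D =>
    (∑ i, (1 / 2 * Real.log (d i / dw i) +
      (L * ((1 + B) * Kw * (1 + B)ᵀ + S) * Lᵀ : Matrix (Fin n) (Fin n) ℝ) i i / (2 * d i) -
        1 / 2 - (H * D * Hᵀ).trace / 2)) / Real.log 2 / n with hv
  have hvc : Continuous (Function.uncurry v) := by
    unfold Function.uncurry
    simp only [hv]
    fun_prop
  have hv0 : v Ks 0 = objective Kw Ks B := by
    rw [objective_eq_sum hw hL]
    simp only [hv, hL.conj, Matrix.diagonal_apply_eq, Matrix.mul_zero, Matrix.zero_mul,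
      Matrix.trace_zero]
    congr 3
    funext i
    have : (d i : ℝ) ≠ 0 := by exact_mod_cast hL.ne_zero i
    field_simp
    ring
  have hvlim : Tendsto (fun k => ENNReal.ofReal (v (S k) (D k))) atTop
      (𝓝 (ENNReal.ofReal (objective Kw Ks B))) := by
    rw [← hv0]
    clear_value v S D
    have h := (hvc.tendsto (Ks, 0)).comp (hSlim.prodMk_nhds hDlim)
    exact ENNReal.tendsto_ofReal h
  refine le_of_tendsto hvlim (Eventually.of_forall fun k => ?_)
  have hu := map_gridIndex (N k)
  have heL2' : CoordL2 (uniformOn (Set.univ : Set (Fin (N k + 1)))) (e k) := fun i =>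
    MemLp.of_discrete
  have hec : crossMoment (uniformOn (Set.univ : Set (Fin (N k + 1)))) (e k) (e k) = S k :=
    (crossMoment_map (F := e k) (G := e k) (measurable_gridIndex (N k)) hu
      (fun i => (measurable_pi_apply i).comp (hme k))
      (fun i => (measurable_pi_apply i).comp (hme k))).symm
  have hmeets : (linearCode (uniformOn Set.univ) (e k) (hme k) B).MeetsPower Kw Kv P := by
    refine linearCode_meetsPower hn hKw.posSemidef hKv hP heL2' hB (le_trans ?_ htr)
    rw [hec, Matrix.trace_add, Matrix.trace_add]
    have := hetr k
    rw [hφc] at this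
    gcongr
  refine le_trans ?_ (hb ⟨_, _, rfl, hmeets, rfl⟩)
  have hDk := posSemidef_crossMoment_self ((heL2 k).sub hφL2)
  have hlaw : correctedLaw (volume : Measure I) (fun t => (φ t).ofLp) B Kw =
      multivariateGaussian 0 ((1 + B) * Kw * (1 + B)ᵀ + Ks) := by
    rw [← correctedLaw_gaussian hKw.posSemidef hKs, ← hφlaw, correctedLaw_map hφ (by fun_prop)]
  have h := le_rate_linearCode hKw.posSemidef hKv hw hK.posSemidef hL hB (hme k) heL2' hn
    (t := (H * D k * Hᵀ).trace / 2)
    (div_nonneg (posSemidef_mul_mul_transpose hDk H).trace_nonneg (by norm_num)) (by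
      rw [← hu, correctedLaw_map (measurable_gridIndex _) (hme k), ← hlaw]
      exact hH volume _ _ (hmg k) (by fun_prop) (heL2 k) hφL2)
  rw [hec] at h
  exact h

lemma zero_le_objective_zero (hKw : Kw.PosDef) : 0 ≤ objective Kw 0 0 := by
  simp [objective, div_self hKw.det_pos.ne']

lemma feasible_zero {P : ℝ} (hP : 0 ≤ P) : Feasible Kw Kv P 0 0 :=
  ⟨Matrix.PosSemidef.zero, fun _ _ _ => rfl, by simpa using by positivity⟩

end NoisyFeedback

open NoisyFeedback
theorem theorem2 {n : ℕ} (hn : 0 < n) (Kw Kv : Matrix (Fin n) (Fin n) ℝ)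
    (hKw : Kw.PosDef) (hKv : Kv.PosSemidef) (P : ℝ) (hP : 0 ≤ P) :
    upperBound Kw Kv P ≠ ∞ ∧
    -- the bound is a maximum over all coding schemes
    IsGreatest (rates Kw Kv P) (upperBound Kw Kv P) ∧
    -- it is also the supremum over the schemes with a uniform message from a finite index set
    IsLUB (finiteMessageRates Kw Kv P) (upperBound Kw Kv P) ∧
    -- it is the optimal value of the matrix problem, which is attained
    IsGreatest {r : ℝ | ∃ Ks B, Feasible Kw Kv P Ks B ∧ objective Kw Ks B = r}
      (upperBound Kw Kv P).toReal ∧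
    -- each feasible pair is realized by a Gaussian scheme with linear feedback
    (∀ Ks B, Feasible Kw Kv P Ks B →
      ∃ c : FeedbackCode n (EuclideanSpace ℝ (Fin n)), IsCoverPombra c Ks B ∧
        c.MeetsPower Kw Kv P ∧ c.rate Kw Kv = ENNReal.ofReal (objective Kw Ks B)) := by
  obtain ⟨Ks, B, hf, hmax⟩ := exists_optimal_feasible hKw hKv hP
  -- The zero pair has objective zero, so the optimum is nonnegative and survives the passage
  -- through `ENNReal.ofReal` and `toReal`.
  have hpos : 0 ≤ objective Kw Ks B :=
    (zero_le_objective_zero hKw).trans (hmax 0 0 (feasible_zero hP))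
  have hgreat : IsGreatest (rates Kw Kv P) (ENNReal.ofReal (objective Kw Ks B)) := by
    constructor
    · obtain ⟨c, -, hc, hr⟩ := exists_coverPombra hn hKw hKv hP hf
      exact ⟨_, _, c, hc, hr⟩
    · rintro _ ⟨𝓜, _, c, hc, rfl⟩
      obtain ⟨Ks', B', hf', hr⟩ := FeedbackCode.rate_le_objective hn hKw hKv hP hc
      exact hr.trans (ENNReal.ofReal_le_ofReal (hmax Ks' B' hf'))
  have hub : upperBound Kw Kv P = ENNReal.ofReal (objective Kw Ks B) := hgreat.isLUB.sSup_eq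
  rw [hub, ENNReal.toReal_ofReal hpos]
  refine ⟨ENNReal.ofReal_ne_top, hgreat, ⟨?_, fun b hb => ?_⟩, ⟨⟨Ks, B, hf, rfl⟩, ?_⟩,
    fun _ _ hf' => exists_coverPombra hn hKw hKv hP hf'⟩
  · rintro _ ⟨N, c, -, hc, rfl⟩
    exact hgreat.2 ⟨_, _, c, hc, rfl⟩
  · exact ofReal_objective_le_of_mem_upperBounds hn hKw hKv hP hf hb
  · rintro _ ⟨Ks', B', hf', rfl⟩
    exact hmax Ks' B' hf'
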